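/- For a partition $\lambda$ and a field $k$ let $M_\lambda=\bigoplus_i k[T]/(T^{\lambda_i})$. If $k$ is finite, let $F_{M_\lambda M_\mu}^{M_\xi}$ be the number of submodules $U\le M_\xi$ with $U\cong M_\mu$ and $M_\xi/U\cong M_\lambda$, and let $F_{\lambda\mu}^\xi\in\mathbb Z[T]$ be the Hall polynomial, i.e. the unique polynomial with $F_{\lambda\mu}^\xi(|k|)=F_{M_\lambda M_\mu}^{M_\xi}$ for every finite field $k$. The generic Ringel–Hall algebra $H_1$ is the $\mathbb Q(v)$-algebra with basis $u_\lambda$ ($\lambda$ running over all partitions) and multiplication $$u_\lambda u_\mu=\sum_\xi F_{\lambda\mu}^\xi(v^2)\,u_\xi ,$$ with unit $u_\emptyset$. Put $q=v^2$, and write $(a)$ for the partition with the single part $a$. Let $\Lambda=\mathbb Q[p_1,p_2,\dots]$ be the ring of symmetric functions ($p_n$ the power sums), let $h_n\in\Lambda$ be the complete symmetric functions, $\sum_{n\ge0}h_nT^n=\exp\big(\sum_{n\ge1}\tfrac1n p_nT^n\big)$, and let $c_n(t)\in\Lambda[t]$ be given by $\sum_{n\ge0}c_n(t)T^n=\exp\big(\sum_{n\ge1}\tfrac{1-t^n}{n}p_nT^n\big)$.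 Proposition. (1) For every integer $r\ge0$, in $H_1$, $$\sum_{a=1}^r q^{a-r}(1-q^{-1})\sum_{|\lambda|=r-a}u_\lambda u_{(a)}=(1-q^{-r})\sum_{|\xi|=r}u_\xi .$$ (2) There is a unique unital ring homomorphism $\Phi_1\colon\Lambda[t]\to H_1$ with $t\mapsto q^{-1}$ and $c_r(t)\mapsto(1-q^{-1})u_{(r)}$ for all $r\ge1$, and it satisfies $$\Phi_1(h_r)=\sum_{|\xi|=r}u_\xi\qquad\text{for every } r\ge0 .$$ -/

import Mathlib

noncomputable section

namespace RingelHall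

open scoped Polynomial PowerSeries

/-! ### Partitions and nilpotent modules -/

/-- The set of all partitions, of all non-negative integers.  For `l : Ptn` the size `|l|` is
`l.1`; the partition itself is `l.2`. -/
abbrev Ptn : Type := Σ n : ℕ, n.Partition

/-- The one-row partition `(a)`; for `a = 0` it is the empty partition. -/
def row (a : ℕ) : Ptn := ⟨a, Nat.Partition.indiscrete a⟩

/-- The nilpotent `k[T]`-module `M_l = ⨁ᵢ k[T] / (T ^ lᵢ)`, one summand for each part of `l`,
counted with multiplicity. -/
abbrev Nilp (k : Type) [Field k] (l : Ptn) : Type :=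
  (i : l.2.parts) → (k[X] ⧸ Ideal.span {(Polynomial.X : k[X]) ^ (i.1 : ℕ)})

/-- The Hall number `F_{l m}^x` over `k`: the number of submodules `U` of `M_x` with `U ≅ M_m` and
`M_x / U ≅ M_l`. -/
def hallNumber (k : Type) [Field k] (l m x : Ptn) : ℕ :=
  Nat.card {U : Submodule k[X] (Nilp k x) //
    Nonempty (U ≃ₗ[k[X]] Nilp k m) ∧ Nonempty ((Nilp k x ⧸ U) ≃ₗ[k[X]] Nilp k l)}

/-- `P` is a Hall polynomial for `(l, m, x)`: its value at `|k|` is the Hall number over `k`, for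
every finite field `k`. -/
def IsHallPolynomial (l m x : Ptn) (P : ℤ[X]) : Prop :=
  ∀ (k : Type) [Field k] [Finite k], P.eval (Nat.card k : ℤ) = (hallNumber k l m x : ℤ)

/-- There are infinitely many finite fields, so a Hall polynomial is unique. -/
theorem IsHallPolynomial.unique {l m x : Ptn} {P Q : ℤ[X]}
    (hP : IsHallPolynomial l m x P) (hQ : IsHallPolynomial l m x Q) : P = Q := by
  refine Polynomial.eq_of_infinite_eval_eq P Q ?_
  have hinf : Set.Infinite ((fun n : ℕ => (n : ℤ)) '' {p : ℕ | p.Prime}) :=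
    Nat.infinite_setOfPred_prime.image (fun a _ b _ h => Int.ofNat_inj.mp h)
  refine hinf.mono ?_
  rintro _ ⟨p, hp, rfl⟩
  have : Fact p.Prime := ⟨hp⟩
  have h1 := hP (ZMod p)
  have h2 := hQ (ZMod p)
  rw [Nat.card_zmod] at h1 h2
  exact h1.trans h2.symm

open Classical in
/-- The Hall polynomial `F_{l m}^x ∈ ℤ[T]`. -/
def hallPolynomial (l m x : Ptn) : ℤ[X] :=
  if h : ∃ P : ℤ[X], IsHallPolynomial l m x P then h.choose else 0

/-! ### The generic Ringel-Hall algebra -/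

/-- The field `ℚ(v)` of rational functions. -/
abbrev Qv : Type := RatFunc ℚ

/-- `q = v ^ 2`. -/
def q : Qv := (RatFunc.X : RatFunc ℚ) ^ 2

/-- The underlying `ℚ(v)`-vector space of `H_1`, with a basis indexed by partitions.  (It is not
reducible, so as not to inherit the pointwise product.) -/
def H1 : Type := Ptn →₀ Qv

instance : AddCommGroup H1 := inferInstanceAs (AddCommGroup (Ptn →₀ Qv))

instance : Module Qv H1 := inferInstanceAs (Module Qv (Ptn →₀ Qv))

/-- The basis of `H_1` indexed by partitions. -/
def basis : Module.Basis Ptn Qv H1 :=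
  Module.Basis.ofRepr (LinearEquiv.refl Qv (Ptn →₀ Qv) : H1 ≃ₗ[Qv] (Ptn →₀ Qv))

/-- The basis element `u_l`. -/
def u (l : Ptn) : H1 := basis l

/-- The product `u_l u_m = ∑_x F_{l m}^x(v ^ 2) u_x`.  Counting dimensions, only the partitions `x`
with `|x| = |l| + |m|` have a non-zero Hall number, so the sum is over these. -/
def basisMul (l m : Ptn) : H1 :=
  ∑ x : (l.1 + m.1).Partition, Polynomial.aeval q (hallPolynomial l m ⟨_, x⟩) • u ⟨_, x⟩

/-- The `ℚ(v)`-bilinear extension of `basisMul`. -/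
def hallMul : H1 →ₗ[Qv] H1 →ₗ[Qv] H1 :=
  basis.constr Qv fun l => basis.constr Qv fun m => basisMul l m

instance : Mul H1 := ⟨fun f g => hallMul f g⟩

/-- The unit is the class of the zero module. -/
instance : One H1 := ⟨u (row 0)⟩

theorem mul_def (f g : H1) : f * g = hallMul f g := rfl

instance : NonUnitalNonAssocRing H1 :=
  { (inferInstance : AddCommGroup H1), (inferInstance : Mul H1) with
    left_distrib := fun a b c => by simp only [mul_def, map_add]
    right_distrib := fun a b c => by simp only [mul_def, map_add, LinearMap.add_apply]
    zero_mul := fun a => by simp only [mul_def, map_zero, LinearMap.zero_apply]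
    mul_zero := fun a => by simp only [mul_def, map_zero] }

theorem u_mul_u (l m : Ptn) : u l * u m = basisMul l m := by
  simp only [mul_def, hallMul, u, Module.Basis.constr_basis]

/-! ### Symmetric functions -/

/-- The ring of symmetric functions `Λ = ℚ[p_1, p_2, …]`. -/
abbrev SymFun : Type := MvPolynomial ℕ+ ℚ

/-- The ring `Λ[t]`. -/
abbrev SymT : Type := Polynomial SymFun

/-- The power sum function `p_n`, for `n ≥ 1` (with the value `0` for `n = 0`). -/
def p (n : ℕ) : SymFun := if h : 0 < n then MvPolynomial.X ⟨n, h⟩ else 0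

/-- The power series `∑_{n ≥ 1} (1 / n) p_n T ^ n`. -/
def logH : SymFun⟦X⟧ := PowerSeries.mk fun n => (1 / n : ℚ) • p n

/-- The complete symmetric function `h_n`, the coefficient of `T ^ n` in
`H(T) = ∏ᵢ (1 - Xᵢ T)⁻¹ = exp (∑_{n ≥ 1} (1 / n) p_n T ^ n)`. -/
def h (n : ℕ) : SymFun := PowerSeries.coeff n ((PowerSeries.exp SymFun).subst logH : SymFun⟦X⟧)

/-- The power series `∑_{n ≥ 1} ((1 - t ^ n) / n) p_n T ^ n`. -/
def logC : SymT⟦X⟧ :=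
  PowerSeries.mk fun n =>
    (1 / n : ℚ) • ((1 - (Polynomial.X : SymT) ^ n) * Polynomial.C (p n))

/-- The cyclic symmetric function `c_n(t)`, the coefficient of `T ^ n` in
`C(T) = exp (∑_{n ≥ 1} ((1 - t ^ n) / n) p_n T ^ n)`. -/
def c (n : ℕ) : SymT := PowerSeries.coeff n ((PowerSeries.exp SymT).subst logC : SymT⟦X⟧)

/-! ### The map `Φ_1` -/

/-- `Φ : Λ[t] → H_1` is a homomorphism of rings with `t ↦ q⁻¹` (times the unit of `H_1`) and
`c_r(t) ↦ (1 - q⁻¹) u_{(r)}` for `r ≥ 1`. -/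
structure IsPhi1 (Φ : SymT →ₙ+* H1) : Prop where
  map_one : Φ 1 = 1
  map_t : Φ Polynomial.X = q⁻¹ • (1 : H1)
  map_c : ∀ r : ℕ, 1 ≤ r → Φ (c r) = (1 - q⁻¹) • u (row r)

end RingelHall

end

noncomputable section

set_option linter.unusedSectionVars false

namespace RingelHall

open scoped Polynomial PowerSeries

/-! ### Dimensions of finite k[T]-modules and ranks of powers of T. -/

section Size

variable (k : Type) [Field k]

/-! Identity (1) counts elements. Let M have type ξ, with |ξ| = r, over a field with q elements.
Each element of M generates a cyclic submodule, and a cyclic module of length a ≥ 1 has q^a -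
q^(a-1) generators. Sorting the q^r elements by the submodule they generate, and these submodules by
the type of the quotient, gives ∑_a (q^a - q^(a-1)) ∑_λ F_{λ(a)}^ξ = q^r - 1 (`sum_hallNumber_row`).
Division by q^r gives the coefficient of u_ξ in (1).

To pass to the generic algebra, Hall polynomials must be shown to exist (`exists_isHallPolynomial`).
A nilpotent module is determined up to isomorphism by the dimensions of T^j M (`hasType_iff`). If U
lies in the socle, the type of M/U is fixed by the dimensions of U ∩ T^j M, and subspaces in
prescribed position to a flag are counted by a polynomial (`exists_flag_polynomial`). This settles
F_{lm}^x for m = (1^r). The general case follows by induction: with m⁻ obtained from m by lowering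
every part by one and r the number of parts, u_{m⁻} u_{(1^r)} is u_m plus terms that come earlier in
the induction (`eq_or_lt_of_hallNumber_ne_zero`), and associativity of Hall numbers is solved for
the term of m.

For (2), H_1 is associative because both bracketings count chains of submodules
(`hallNumber_assoc`), and commutative because M_x carries a nondegenerate symmetric form with T
self-adjoint (`hallNumber_comm`). The logarithmic derivative of ∑ c_n T^n has coefficients (1 - t^n)
p_n, and 1 - q^(-n) is invertible, so the images of the c_r can be prescribed in exactly one way
(`exists_ringHom`, `ringHom_eq_of_map_c_eq`). Finally C(T) H(tT) = H(T) becomes under Φ_1 the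
recursion (1), which determines Φ_1(h_r) since 1 - q^(-r) ≠ 0 for r ≥ 1 (`map_h_eq`). -/

/-- The dimension over a finite field `k` of a finite module over `k[X]`. -/
def sz (M : Type) : ℕ := Nat.log (Nat.card k) (Nat.card M)

/-- The endomorphism of a `k[X]`-module given by the `j`-th power of the variable. -/
abbrev shiftMap (M : Type) [AddCommGroup M] [Module k[X] M] (j : ℕ) : M →ₗ[k[X]] M :=
  LinearMap.lsmul k[X] M (Polynomial.X ^ j)

/-- The dimension of `T ^ j M`. -/
def rk (M : Type) [AddCommGroup M] [Module k[X] M] (j : ℕ) : ℕ :=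
  sz k (LinearMap.range (shiftMap k M j))

variable {k}
variable {M N : Type} [AddCommGroup M] [Module k[X] M] [AddCommGroup N] [Module k[X] N]

theorem sz_congr (e : M ≃ N) : sz k M = sz k N := by
  rw [sz, sz, Nat.card_congr e]

theorem rk_congr (e : M ≃ₗ[k[X]] N) (j : ℕ) : rk k M j = rk k N j := by
  refine sz_congr (e.submoduleMap (LinearMap.range (shiftMap k M j)) ≪≫ₗ
    LinearEquiv.ofEq _ _ ?_).toEquiv
  ext y
  simp only [Submodule.mem_map, LinearMap.mem_range, LinearMap.lsmul_apply]
  constructor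
  · rintro ⟨_, ⟨x, rfl⟩, rfl⟩
    exact ⟨e x, by simp⟩
  · rintro ⟨x, rfl⟩
    exact ⟨_, ⟨e.symm x, rfl⟩, by simp⟩

variable [Finite k]

theorem one_lt_card : 1 < Nat.card k := Finite.one_lt_card

/-- Constants make M a k-vector space, so the rounded logarithm in `sz` is exact. -/
theorem card_eq_pow_sz (M : Type) [AddCommGroup M] [Module k[X] M] [Finite M] :
    Nat.card M = Nat.card k ^ sz k M := by
  let _ : Module k M := Module.compHom M (algebraMap k k[X])
  have h := Module.natCard_eq_pow_finrank (K := k) (V := M)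
  rw [sz, h, Nat.log_pow one_lt_card]

theorem sz_eq_iff [Finite M] {n : ℕ} : sz k M = n ↔ Nat.card M = Nat.card k ^ n := by
  rw [card_eq_pow_sz (k := k) M, (Nat.pow_right_injective one_lt_card).eq_iff]

theorem sz_eq_of_card_eq [Finite M] {n : ℕ} (h : Nat.card M = Nat.card k ^ n) : sz k M = n :=
  sz_eq_iff.2 h

variable [Finite M] [Finite N]

instance finite_quotient (U : Submodule k[X] M) : Finite (M ⧸ U) :=
  Finite.of_surjective U.mkQ U.mkQ_surjective

theorem sz_add_sz_quotient (U : Submodule k[X] M) : sz k U + sz k (M ⧸ U) = sz k M := by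
  symm
  rw [sz_eq_iff, Submodule.card_eq_card_quotient_mul_card U, card_eq_pow_sz (k := k) U,
    card_eq_pow_sz (k := k) (M ⧸ U), pow_add, mul_comm]

theorem sz_ker_add_sz_range (f : M →ₗ[k[X]] N) :
    sz k (LinearMap.ker f) + sz k (LinearMap.range f) = sz k M := by
  rw [← sz_add_sz_quotient (LinearMap.ker f), sz_congr f.quotKerEquivRange.toEquiv]

theorem sz_mono {U V : Submodule k[X] M} (h : U ≤ V) : sz k U ≤ sz k V := by
  have := Nat.card_mono (Set.toFinite (V : Set M)) h
  exact Nat.log_mono_right this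

theorem eq_of_le_of_sz_le {U V : Submodule k[X] M} (h : U ≤ V) (h' : sz k V ≤ sz k U) :
    U = V := by
  have e : sz k U = sz k V := le_antisymm (sz_mono h) h'
  apply SetLike.coe_injective
  refine Set.eq_of_subset_of_ncard_le h ?_
  have h1 := card_eq_pow_sz (k := k) U
  have h2 := card_eq_pow_sz (k := k) V
  rw [e, ← h2] at h1
  exact h1.ge

theorem sz_eq_zero_iff {U : Submodule k[X] M} : sz k U = 0 ↔ U = ⊥ := by
  have hb : sz k (⊥ : Submodule k[X] M) = 0 := by
    rw [sz_eq_iff]; simp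
  constructor
  · intro h
    exact (eq_of_le_of_sz_le bot_le (by omega)).symm
  · rintro rfl; exact hb

theorem sz_top : sz k (⊤ : Submodule k[X] M) = sz k M :=
  sz_congr Submodule.topEquiv.toEquiv

theorem rk_zero : rk k M 0 = sz k M := by
  rw [rk, show LinearMap.range (shiftMap k M 0) = ⊤ from ?_, sz_top]
  rw [LinearMap.range_eq_top]
  intro x
  exact ⟨x, by simp⟩

/-- Rank-nullity for T^j M → M/U: the image is T^j(M/U), the kernel U ∩ T^j M. -/
theorem rk_quotient_add (U : Submodule k[X] M) (j : ℕ) :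
    rk k (M ⧸ U) j + sz k (U ⊓ LinearMap.range (shiftMap k M j) : Submodule k[X] M) =
      rk k M j := by
  set R := LinearMap.range (shiftMap k M j) with hR
  let f : R →ₗ[k[X]] M ⧸ U := U.mkQ ∘ₗ R.subtype
  have hf := sz_ker_add_sz_range f
  have h1 : LinearMap.range f = LinearMap.range (shiftMap k (M ⧸ U) j) := by
    ext y
    simp only [f, LinearMap.mem_range, LinearMap.comp_apply, Submodule.subtype_apply,
      Submodule.mkQ_apply, Subtype.exists, LinearMap.lsmul_apply]
    constructor
    · rintro ⟨a, ⟨x, rfl⟩, rfl⟩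
      exact ⟨Submodule.Quotient.mk x, rfl⟩
    · rintro ⟨x, rfl⟩
      obtain ⟨x, rfl⟩ := Submodule.Quotient.mk_surjective _ x
      exact ⟨_, ⟨x, rfl⟩, rfl⟩
  have h2 : sz k (LinearMap.ker f) = sz k (U ⊓ R : Submodule k[X] M) := by
    refine sz_congr ⟨fun x => ⟨x.1.1, ?_, x.1.2⟩, fun x => ⟨⟨x.1, x.2.2⟩, ?_⟩, fun _ => rfl,
      fun _ => rfl⟩
    · exact (Submodule.Quotient.mk_eq_zero U).1 (show f x.1 = 0 from x.2)
    · simpa [f] using x.2.1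
  rw [rk, ← h1, rk, ← hR]
  omega

/-- Rank-nullity for x ↦ T^j x mod U. -/
theorem sz_quotient_add_sz_comap (U : Submodule k[X] M) (j : ℕ) :
    sz k (U.comap (shiftMap k M j)) + rk k (M ⧸ U) j = sz k M := by
  let f : M →ₗ[k[X]] M ⧸ U := U.mkQ ∘ₗ shiftMap k M j
  have hf := sz_ker_add_sz_range f
  have h1 : LinearMap.range f = LinearMap.range (shiftMap k (M ⧸ U) j) := by
    ext y
    simp only [f, LinearMap.mem_range, LinearMap.comp_apply, Submodule.mkQ_apply,
      LinearMap.lsmul_apply]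
    constructor
    · rintro ⟨x, rfl⟩
      exact ⟨Submodule.Quotient.mk x, rfl⟩
    · rintro ⟨x, rfl⟩
      obtain ⟨x, rfl⟩ := Submodule.Quotient.mk_surjective _ x
      exact ⟨x, rfl⟩
  have h2 : LinearMap.ker f = U.comap (shiftMap k M j) := by
    rw [LinearMap.ker_comp, Submodule.ker_mkQ]
  rwa [h1, h2] at hf

theorem rk_submodule (U : Submodule k[X] M) (j : ℕ) :
    rk k U j = sz k (U.map (shiftMap k M j)) := by
  refine sz_congr ((Submodule.equivMapOfInjective U.subtype U.injective_subtype _).toEquiv.trans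
    (Equiv.setCongr ?_))
  ext y
  simp only [SetLike.mem_coe, Submodule.mem_map, LinearMap.mem_range, Submodule.subtype_apply,
    LinearMap.lsmul_apply]
  constructor
  · rintro ⟨_, ⟨x, rfl⟩, rfl⟩
    exact ⟨x.1, x.2, rfl⟩
  · rintro ⟨x, hx, rfl⟩
    exact ⟨_, ⟨⟨x, hx⟩, rfl⟩, rfl⟩

/-- The socle, i.e. the kernel of the variable. -/
def soc (k : Type) [Field k] (M : Type) [AddCommGroup M] [Module k[X] M] : Submodule k[X] M :=
  LinearMap.ker (shiftMap k M 1)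

omit [Finite k] [Finite M] in
theorem mem_soc {x : M} : x ∈ soc k M ↔ (Polynomial.X : k[X]) • x = 0 := by
  simp [soc]

/-- Rank-nullity for multiplication by T from T^j M onto T^(j+1) M. -/
theorem sz_soc_inf_add (j : ℕ) :
    sz k (soc k M ⊓ LinearMap.range (shiftMap k M j) : Submodule k[X] M) + rk k M (j + 1) =
      rk k M j := by
  set R := LinearMap.range (shiftMap k M j) with hR
  let f : R →ₗ[k[X]] M := shiftMap k M 1 ∘ₗ R.subtype
  have hf := sz_ker_add_sz_range f
  have h1 : LinearMap.range f = LinearMap.range (shiftMap k M (j + 1)) := by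
    ext y
    simp only [f, LinearMap.mem_range, LinearMap.comp_apply, Submodule.subtype_apply,
      Subtype.exists, LinearMap.lsmul_apply, pow_one]
    constructor
    · rintro ⟨a, ⟨x, rfl⟩, rfl⟩
      exact ⟨x, by rw [LinearMap.lsmul_apply, smul_smul, pow_succ']⟩
    · rintro ⟨x, rfl⟩
      exact ⟨_, ⟨x, rfl⟩, by rw [LinearMap.lsmul_apply, smul_smul, pow_succ']⟩
  have h2 : sz k (LinearMap.ker f) = sz k (soc k M ⊓ R : Submodule k[X] M) := by
    refine sz_congr ⟨fun x => ⟨x.1.1, ?_, x.1.2⟩, fun x => ⟨⟨x.1, x.2.2⟩, ?_⟩, fun _ => rfl,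
      fun _ => rfl⟩
    · exact (show f x.1 = 0 from x.2)
    · have := mem_soc.1 x.2.1
      simpa [f] using this
  rw [rk, ← h1, rk, ← hR]
  omega

theorem sz_soc_add : sz k (soc k M) + rk k M 1 = sz k M := by
  have := sz_soc_inf_add (k := k) (M := M) 0
  rw [rk_zero] at this
  rw [← this, zero_add]
  congr 1
  have : LinearMap.range (shiftMap k M 0) = ⊤ := by
    rw [LinearMap.range_eq_top]
    intro x
    exact ⟨x, by simp⟩
  rw [this, inf_top_eq]

end Size

/-! ### Nilpotent modules. -/

/-- The variable acts nilpotently. -/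
def IsNilp (k : Type) [Field k] (M : Type) [AddCommGroup M] [Module k[X] M] : Prop :=
  ∃ n : ℕ, ∀ x : M, (Polynomial.X : k[X]) ^ n • x = 0

section

variable {k : Type} [Field k]
variable {M N : Type} [AddCommGroup M] [Module k[X] M] [AddCommGroup N] [Module k[X] N]

theorem IsNilp.submodule (h : IsNilp k M) (U : Submodule k[X] M) : IsNilp k U := by
  obtain ⟨n, hn⟩ := h
  exact ⟨n, fun x => Subtype.ext (hn x.1)⟩

theorem IsNilp.quotient (h : IsNilp k M) (U : Submodule k[X] M) : IsNilp k (M ⧸ U) := by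
  obtain ⟨n, hn⟩ := h
  refine ⟨n, fun x => ?_⟩
  obtain ⟨x, rfl⟩ := Submodule.Quotient.mk_surjective _ x
  rw [← Submodule.Quotient.mk_smul, hn, Submodule.Quotient.mk_zero]

end

/-! ### Partitions and their rank sequences. -/

/-- The sum of the numbers `max (lᵢ - j) 0`, i.e. the dimension of `T ^ j M_l`. -/
def prk (j : ℕ) (l : Ptn) : ℕ := (l.2.parts.map (· - j)).sum

/-- The partition given by the non-zero elements of a multiset. -/
def ofMS (s : Multiset ℕ) : Ptn := ⟨s.sum, Nat.Partition.ofMultiset s⟩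

theorem ofMS_parts (s : Multiset ℕ) : (ofMS s).2.parts = s.filter (· ≠ 0) := rfl

theorem prk_ofMS (j : ℕ) (s : Multiset ℕ) : prk j (ofMS s) = (s.map (· - j)).sum := by
  rw [prk, ofMS_parts]
  induction s using Multiset.induction_on with
  | empty => simp
  | cons a s ih =>
    by_cases ha : a = 0
    · simp [ha, ih]
    · rw [Multiset.filter_cons_of_pos s ha]
      simp [ih]

theorem prk_zero (l : Ptn) : prk 0 l = l.1 := by
  simp [prk, l.2.parts_sum]

theorem row_eq_ofMS (a : ℕ) : row a = ofMS {a} := rfl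

theorem prk_row (j a : ℕ) : prk j (row a) = a - j := by
  rw [row_eq_ofMS, prk_ofMS]; simp

/-- The second difference of j ↦ max(x - j, 0) is the indicator of a single value of j, so second
differences of the rank sequence are multiplicities of parts. -/
theorem count_add_two_mul_sum (s : Multiset ℕ) (a : ℕ) :
    s.count (a + 1) + 2 * (s.map (· - (a + 1))).sum =
      (s.map (· - a)).sum + (s.map (· - (a + 2))).sum := by
  induction s using Multiset.induction_on with
  | empty => simp
  | cons x s ih =>
    simp only [Multiset.count_cons, Multiset.map_cons, Multiset.sum_cons]
    split_ifs <;> omega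

theorem prk_injective {l m : Ptn} (h : ∀ j, prk j l = prk j m) : l = m := by
  have h0 := h 0
  rw [prk_zero, prk_zero] at h0
  obtain ⟨n, l⟩ := l
  obtain ⟨n', m⟩ := m
  dsimp only at h0
  subst h0
  congr 1
  ext1
  ext a
  cases a with
  | zero =>
    rw [Multiset.count_eq_zero_of_notMem fun h => (l.parts_pos h).ne rfl,
      Multiset.count_eq_zero_of_notMem fun h => (m.parts_pos h).ne rfl]
  | succ a =>
    have h1 := count_add_two_mul_sum l.parts a
    have h2 := count_add_two_mul_sum m.parts a
    have h3 := h a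
    have h4 := h (a + 1)
    have h5 := h (a + 2)
    simp only [prk] at h3 h4 h5
    omega

/-! ### Products of cyclic modules. -/

/-- The cyclic module `k[T] / (T ^ a)`. -/
abbrev Cyc (k : Type) [Field k] (a : ℕ) : Type :=
  k[X] ⧸ Ideal.span {(Polynomial.X : k[X]) ^ a}

section

variable {k : Type} [Field k]

theorem Cyc.mk_eq_zero {a : ℕ} {f : k[X]} :
    (Submodule.Quotient.mk f : Cyc k a) = 0 ↔ (Polynomial.X : k[X]) ^ a ∣ f := by
  rw [Submodule.Quotient.mk_eq_zero, Ideal.mem_span_singleton]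

/-- Multiplication by T^j on k[T]/(T^a) has kernel generated by T^(a-j). For j > a the truncated
difference is 0 and both modules in question vanish. -/
theorem exists_mul_equiv (a j : ℕ) : ∃ φ : Cyc k (a - j) →ₗ[k[X]] Cyc k a,
    Function.Injective φ ∧ LinearMap.range φ = LinearMap.range (shiftMap k (Cyc k a) j) := by
  let ψ : k[X] →ₗ[k[X]] Cyc k a :=
    shiftMap k (Cyc k a) j ∘ₗ Submodule.mkQ (Ideal.span {(Polynomial.X : k[X]) ^ a})
  have hψ : ∀ f, ψ f = Submodule.Quotient.mk (Polynomial.X ^ j * f) := fun f => rfl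
  have hker : Ideal.span {(Polynomial.X : k[X]) ^ (a - j)} = LinearMap.ker ψ := by
    ext f
    rw [LinearMap.mem_ker, hψ, Cyc.mk_eq_zero, Ideal.mem_span_singleton]
    by_cases h : j ≤ a
    · conv_rhs => rw [← Nat.add_sub_cancel' h, pow_add]
      rw [mul_dvd_mul_iff_left (pow_ne_zero _ Polynomial.X_ne_zero)]
    · rw [Nat.sub_eq_zero_of_le (by omega)]
      simp only [pow_zero, one_dvd, true_iff]
      exact Dvd.dvd.mul_right (pow_dvd_pow _ (by omega)) _
  refine ⟨Submodule.liftQ _ ψ hker.le, ?_, ?_⟩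
  · rw [← LinearMap.ker_eq_bot]
    exact Submodule.ker_liftQ_eq_bot _ _ _ hker.ge
  · rw [Submodule.range_liftQ, LinearMap.range_comp_of_range_eq_top _ (Submodule.range_mkQ _)]

theorem isNilp_pi {ι : Type} [Finite ι] (f : ι → ℕ) : IsNilp k ((i : ι) → Cyc k (f i)) := by
  have := Fintype.ofFinite ι
  refine ⟨∑ i, f i, fun x => funext fun i => ?_⟩
  obtain ⟨y, hy⟩ := Submodule.Quotient.mk_surjective _ (x i)
  rw [Pi.smul_apply, ← hy, ← Submodule.Quotient.mk_smul, Pi.zero_apply, Cyc.mk_eq_zero]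
  exact Dvd.dvd.mul_right (pow_dvd_pow _ (Finset.single_le_sum (f := f) (by simp) (by simp))) _

theorem isNilp_nilp (l : Ptn) : IsNilp k (Nilp k l) := isNilp_pi fun i : l.2.parts => i.1

/-- Factors with exponent 0 are zero modules and may be dropped; the others are reindexed by the
parts of the partition. -/
theorem pi_equiv_nilp {ι : Type} [Fintype ι] (f : ι → ℕ) :
    Nonempty (((i : ι) → Cyc k (f i)) ≃ₗ[k[X]] Nilp k (ofMS (Finset.univ.val.map f))) := by
  classical
  set s : Multiset ℕ := (ofMS (Finset.univ.val.map f)).2.parts with hs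
  have hs' : s = (Finset.univ.val : Multiset {i // f i ≠ 0}).map fun i => f i.1 := by
    rw [hs, ofMS_parts, Multiset.filter_map]
    have h1 := congrArg Finset.val (Finset.univ.subtype_map (p := fun i => f i ≠ 0))
    rw [Finset.subtype_univ, Finset.map_val, Finset.filter_val] at h1
    simp only [Function.comp_def]
    rw [← h1, Multiset.map_map]
    rfl
  -- Each value occurs equally often on both sides, so bijections between the fibres glue to one
  -- that preserves the exponent.
  obtain ⟨e, he⟩ : ∃ e : s ≃ {i // f i ≠ 0}, ∀ x, f (e x).1 = x.1 := by
    have h : ∀ a : ℕ, Nonempty ({x : s // x.1 = a} ≃ {i : {i // f i ≠ 0} // f i.1 = a}) := by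
      intro a
      rw [← Fintype.card_eq, Fintype.card_subtype, Fintype.card_subtype]
      have h1 : s.count a = (Finset.univ.filter fun x : s => x.1 = a).card := by
        conv_lhs => rw [← Multiset.map_univ_coe s]
        rw [Multiset.count_map, Finset.card_def, Finset.filter_val]
        simp only [eq_comm]
      rw [← h1, hs', Multiset.count_map, Finset.card_def, Finset.filter_val]
      simp only [eq_comm]
    let g' := fun a => Classical.choice (h a)
    refine ⟨(Equiv.sigmaFiberEquiv fun x : s => x.1).symm.trans
      ((Equiv.sigmaCongrRight g').trans
        (Equiv.sigmaFiberEquiv fun i : {i // f i ≠ 0} => f i.1)), fun x => ?_⟩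
    exact (g' x.1 ⟨x, rfl⟩).2
  have hI : ∀ x : s, Ideal.span {(Polynomial.X : k[X]) ^ f (e x).1} =
      Ideal.span {(Polynomial.X : k[X]) ^ x.1} := fun x => by rw [he]
  let E : ∀ x : s, Cyc k (f (e x).1) ≃ₗ[k[X]] Cyc k x.1 := fun x =>
    Submodule.quotEquivOfEq _ _ (hI x)
  let θ : ((i : ι) → Cyc k (f i)) →ₗ[k[X]] ((x : s) → Cyc k x.1) :=
    LinearMap.pi fun x => (E x).toLinearMap ∘ₗ LinearMap.proj (e x).1
  refine ⟨LinearEquiv.ofBijective θ ⟨?_, ?_⟩⟩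
  · rw [injective_iff_map_eq_zero]
    intro y hy
    funext i
    by_cases hi : f i = 0
    · obtain ⟨z, hz⟩ := Submodule.Quotient.mk_surjective _ (y i)
      rw [← hz, Pi.zero_apply, Cyc.mk_eq_zero, hi]
      simp
    · have h1 := congrFun hy (e.symm ⟨i, hi⟩)
      have h2 : E (e.symm ⟨i, hi⟩) (y (e (e.symm ⟨i, hi⟩)).1) = 0 := h1
      rw [LinearEquiv.map_eq_zero_iff, Equiv.apply_symm_apply] at h2
      exact h2
  · intro z
    refine ⟨fun i => if hi : f i ≠ 0 then
      Submodule.quotEquivOfEq _ _ (by rw [← he, Equiv.apply_symm_apply])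
        (z (e.symm ⟨i, hi⟩)) else 0, ?_⟩
    funext x
    have : ∀ (w : {i // f i ≠ 0}) (x : s) (hx : e.symm w = x) (h' h''),
        (Submodule.quotEquivOfEq (Ideal.span {(Polynomial.X : k[X]) ^ f w.1})
          (Ideal.span {(Polynomial.X : k[X]) ^ x.1}) h')
        ((Submodule.quotEquivOfEq (Ideal.span {(Polynomial.X : k[X]) ^ (e.symm w).1})
          (Ideal.span {(Polynomial.X : k[X]) ^ f w.1}) h'') (z (e.symm w))) = z x := by
      rintro w x rfl h' h''
      obtain ⟨y, hy⟩ := Submodule.Quotient.mk_surjective _ (z (e.symm w))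
      rw [← hy]
      rfl
    have h3 : f (e x).1 ≠ 0 := (e x).2
    change E x (dite _ _ _) = _
    rw [dif_pos h3]
    exact this (e x) x (by simp) _ _

variable [Finite k]

theorem card_cyc (a : ℕ) : Finite (Cyc k a) ∧ Nat.card (Cyc k a) = Nat.card k ^ a := by
  have h0 : (Polynomial.X ^ a : k[X]) ≠ 0 := pow_ne_zero _ Polynomial.X_ne_zero
  have := (Polynomial.monic_X_pow (R := k) a).finite_quotient
  have h2 : Module.finrank k (Cyc k a) = a := by
    rw [finrank_quotient_span_eq_natDegree, Polynomial.natDegree_X_pow]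
  refine ⟨Module.finite_of_finite k, ?_⟩
  rw [Module.natCard_eq_pow_finrank (K := k), h2]

instance finite_cyc (a : ℕ) : Finite (Cyc k a) := (card_cyc a).1

theorem card_pi_cyc {ι : Type} [Fintype ι] (f : ι → ℕ) :
    Nat.card ((i : ι) → Cyc k (f i)) = Nat.card k ^ ∑ i, f i := by
  rw [Nat.card_pi, ← Finset.prod_pow_eq_pow_sum]
  exact Finset.prod_congr rfl fun i _ => (card_cyc (f i)).2

theorem rk_pi_cyc {ι : Type} [Fintype ι] (f : ι → ℕ) (j : ℕ) :
    rk k ((i : ι) → Cyc k (f i)) j = ∑ i, (f i - j) := by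
  choose φ hφ hr using fun i => exists_mul_equiv (k := k) (f i) j
  let Φ : ((i : ι) → Cyc k (f i - j)) →ₗ[k[X]] ((i : ι) → Cyc k (f i)) :=
    LinearMap.pi fun i => φ i ∘ₗ LinearMap.proj i
  have hΦ : Function.Injective Φ := fun x y h => funext fun i => hφ i (congrFun h i)
  have hR : LinearMap.range Φ = LinearMap.range (shiftMap k ((i : ι) → Cyc k (f i)) j) := by
    ext y
    constructor
    · rintro ⟨x, rfl⟩
      have : ∀ i, φ i (x i) ∈ LinearMap.range (shiftMap k (Cyc k (f i)) j) := fun i =>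
        hr i ▸ ⟨x i, rfl⟩
      choose z hz using this
      exact ⟨z, funext hz⟩
    · rintro ⟨x, rfl⟩
      have : ∀ i, shiftMap k (Cyc k (f i)) j (x i) ∈ LinearMap.range (φ i) := fun i =>
        (hr i).symm ▸ ⟨x i, rfl⟩
      choose z hz using this
      exact ⟨z, funext hz⟩
  rw [rk, ← hR, ← sz_congr (LinearEquiv.ofInjective Φ hΦ).toEquiv]
  exact sz_eq_of_card_eq (card_pi_cyc fun i => f i - j)

theorem rk_nilp (l : Ptn) (j : ℕ) : rk k (Nilp k l) j = prk j l := by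
  rw [rk_pi_cyc (fun i : l.2.parts => i.1) j, prk, ← Multiset.map_univ (l.2.parts) (· - j)]
  rfl

instance finite_nilp (l : Ptn) : Finite (Nilp k l) := Pi.finite

end

/-! ### The type of a nilpotent module. -/

/-- A module is isomorphic to `M_l`. -/
def HasType (k : Type) [Field k] (M : Type) [AddCommGroup M] [Module k[X] M] (l : Ptn) : Prop :=
  Nonempty (M ≃ₗ[k[X]] Nilp k l)

section

variable {k : Type} [Field k]
variable {M N : Type} [AddCommGroup M] [Module k[X] M] [AddCommGroup N] [Module k[X] N]

theorem hasType_congr {l : Ptn} (e : M ≃ₗ[k[X]] N) : HasType k M l ↔ HasType k N l :=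
  ⟨fun ⟨f⟩ => ⟨e.symm ≪≫ₗ f⟩, fun ⟨f⟩ => ⟨e ≪≫ₗ f⟩⟩

variable [Finite k]

theorem HasType.rk_eq {l : Ptn} (h : HasType k M l) (j : ℕ) : rk k M j = prk j l := by
  obtain ⟨e⟩ := h
  rw [rk_congr e, rk_nilp]

theorem HasType.unique {l m : Ptn} (h : HasType k M l) (h' : HasType k M m) : l = m :=
  prk_injective fun j => by rw [← h.rk_eq, ← h'.rk_eq]

variable [Finite M] [Finite N]

theorem exists_hasType (h : IsNilp k M) : ∃ l, HasType k M l := by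
  obtain ⟨n, hn⟩ := h
  obtain ⟨d, f, ⟨e⟩⟩ := Module.torsion_by_prime_power_decomposition
    (p := (Polynomial.X : k[X])) (M := M) Polynomial.irreducible_X
    (fun {x} => ⟨⟨_, n, rfl⟩, hn x⟩)
  obtain ⟨e'⟩ := pi_equiv_nilp (k := k) f
  exact ⟨_, ⟨e ≪≫ₗ DirectSum.linearEquivFunOnFintype _ _ _ ≪≫ₗ e'⟩⟩

/-- The structure theorem provides some type, and rank sequences separate partitions. Every later
determination of a type thus reduces to computing dimensions. -/
theorem hasType_iff (h : IsNilp k M) {l : Ptn} : HasType k M l ↔ ∀ j, rk k M j = prk j l := by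
  refine ⟨fun h => h.rk_eq, fun h' => ?_⟩
  obtain ⟨m, hm⟩ := exists_hasType h
  rwa [show l = m from prk_injective fun j => by rw [← h', hm.rk_eq]]

theorem HasType.sz_eq {l : Ptn} (h : HasType k M l) : sz k M = l.1 := by
  rw [← rk_zero, h.rk_eq, prk_zero]

end

/-! ### Hyperplanes in subspaces of the socle. -/

section

variable {k : Type} [Field k]
variable {M : Type} [AddCommGroup M] [Module k[X] M]

/-- On the socle k[T] acts through constant terms, so submodules there are just subspaces. -/
theorem smul_eq_of_mem_soc {z : M} (hz : z ∈ soc k M) (f : k[X]) :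
    f • z = Polynomial.C (f.coeff 0) • z := by
  conv_lhs => rw [← Polynomial.divX_mul_X_add f]
  rw [add_smul, mul_smul, mem_soc.1 hz, smul_zero, zero_add]

theorem mem_of_C_smul_mem {U : Submodule k[X] M} {c : k} (hc : c ≠ 0) {z : M}
    (h : Polynomial.C c • z ∈ U) : z ∈ U := by
  have := U.smul_mem (Polynomial.C c⁻¹) h
  rwa [smul_smul, ← Polynomial.C_mul, inv_mul_cancel₀ hc, Polynomial.C_1, one_smul] at this

theorem mem_sup_span_iff {U : Submodule k[X] M} {z : M} (hz : z ∈ soc k M) {x : M} :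
    x ∈ U ⊔ Submodule.span k[X] {z} ↔ ∃ u ∈ U, ∃ c : k, x = Polynomial.C c • z + u := by
  rw [Submodule.mem_sup]
  constructor
  · rintro ⟨u, hu, y, hy, rfl⟩
    obtain ⟨f, rfl⟩ := Submodule.mem_span_singleton.1 hy
    exact ⟨u, hu, f.coeff 0, by rw [← smul_eq_of_mem_soc hz, add_comm]⟩
  · rintro ⟨u, hu, c, rfl⟩
    exact ⟨u, hu, _, Submodule.smul_mem _ _ (Submodule.mem_span_singleton_self z), add_comm _ _⟩

/-- An element of U outside H has a nonzero coefficient at z, which can be scaled to 1. -/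
theorem exists_add_mem {H W U : Submodule k[X] M} {z : M} (hz : z ∈ soc k M)
    (hW : H ⊔ Submodule.span k[X] {z} = W) (hU : U ≤ W) (hUH : ¬ U ≤ H) :
    ∃ h ∈ H, z + h ∈ U := by
  obtain ⟨u, hu, huH⟩ := Set.not_subset.1 hUH
  have h1 := hU hu
  rw [← hW, mem_sup_span_iff hz] at h1
  obtain ⟨h, hh, c, rfl⟩ := h1
  have hc : c ≠ 0 := by
    rintro rfl
    simp only [map_zero, zero_smul, zero_add] at huH
    exact huH hh
  refine ⟨Polynomial.C c⁻¹ • h, H.smul_mem _ hh, ?_⟩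
  have h2 := U.smul_mem (Polynomial.C c⁻¹) hu
  rwa [smul_add, smul_smul, ← Polynomial.C_mul, inv_mul_cancel₀ hc, Polynomial.C_1,
    one_smul] at h2

theorem inf_sup_span {H W U : Submodule k[X] M} {z h : M} (hz : z ∈ soc k M)
    (hW : H ⊔ Submodule.span k[X] {z} = W) (hU : U ≤ W) (hh : h ∈ H) (hzU : z + h ∈ U) :
    (U ⊓ H) ⊔ Submodule.span k[X] {z + h} = U := by
  apply le_antisymm
  · refine sup_le inf_le_left ?_
    rwa [Submodule.span_singleton_le_iff_mem]
  · intro u hu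
    have h1 := hU hu
    rw [← hW, mem_sup_span_iff hz] at h1
    obtain ⟨h', hh', c, rfl⟩ := h1
    have h2 : Polynomial.C c • z + h' = (h' - Polynomial.C c • h) + Polynomial.C c • (z + h) := by
      rw [smul_add]; abel
    rw [h2]
    refine Submodule.add_mem_sup ⟨?_, H.sub_mem hh' (H.smul_mem _ hh)⟩
      (Submodule.smul_mem _ _ (Submodule.mem_span_singleton_self _))
    have h3 := U.sub_mem hu (U.smul_mem (Polynomial.C c) hzU)
    rwa [h2, add_sub_cancel_right] at h3

theorem sup_span_inf {H U : Submodule k[X] M} {z : M} (hz : z ∈ soc k M) (hzH : z ∉ H)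
    (hU : U ≤ H) : (U ⊔ Submodule.span k[X] {z}) ⊓ H = U := by
  apply le_antisymm
  · rintro x ⟨hx, hxH⟩
    obtain ⟨u, hu, c, rfl⟩ := (mem_sup_span_iff hz).1 hx
    by_cases hc : c = 0
    · simpa [hc] using hu
    · refine absurd (mem_of_C_smul_mem hc ?_) hzH
      simpa using H.sub_mem hxH (hU hu)
  · exact le_inf le_sup_left hU

variable [Finite k] [Finite M]

theorem sz_sup_span {U : Submodule k[X] M} {z : M} (hz : z ∈ soc k M) (hzU : z ∉ U) :
    sz k (U ⊔ Submodule.span k[X] {z} : Submodule k[X] M) = sz k U + 1 := by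
  rw [sz_eq_iff, pow_succ', ← card_eq_pow_sz, ← Nat.card_prod]
  symm
  let g : k × U → (U ⊔ Submodule.span k[X] {z} : Submodule k[X] M) := fun p =>
    ⟨Polynomial.C p.1 • z + p.2.1, (mem_sup_span_iff hz).2 ⟨_, p.2.2, _, rfl⟩⟩
  refine Nat.card_congr (Equiv.ofBijective g ⟨?_, ?_⟩)
  · rintro ⟨c, u⟩ ⟨c', u'⟩ h
    have h1 : Polynomial.C c • z + u.1 = Polynomial.C c' • z + u'.1 := congrArg Subtype.val h
    have h2 : c = c' := by
      by_contra hc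
      refine hzU (mem_of_C_smul_mem (sub_ne_zero.2 hc) ?_)
      have h3 : Polynomial.C (c - c') • z = u'.1 - u.1 := by
        rw [Polynomial.C_sub, sub_smul, sub_eq_sub_iff_add_eq_add, h1, add_comm]
      rw [h3]
      exact U.sub_mem u'.2 u.2
    subst h2
    rw [add_right_inj] at h1
    exact Prod.ext rfl (Subtype.ext h1)
  · rintro ⟨x, hx⟩
    obtain ⟨u, hu, c, rfl⟩ := (mem_sup_span_iff hz).1 hx
    exact ⟨(c, ⟨u, hu⟩), rfl⟩

theorem exists_hyperplane {L W : Submodule k[X] M} (hLW : L < W) :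
    ∃ (H : Submodule k[X] M) (z : M), L ≤ H ∧ z ∈ W ∧ z ∉ H ∧
      H ⊔ Submodule.span k[X] {z} = W := by
  obtain ⟨H, hH⟩ := (Set.toFinite {H : Submodule k[X] M | L ≤ H ∧ H < W}).exists_maximal
    ⟨L, le_rfl, hLW⟩
  obtain ⟨z, hzW, hzH⟩ := SetLike.exists_of_lt hH.prop.2
  refine ⟨H, z, hH.prop.1, hzW, hzH, ?_⟩
  have h1 : H ⊔ Submodule.span k[X] {z} ≤ W :=
    sup_le hH.prop.2.le (by rwa [Submodule.span_singleton_le_iff_mem])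
  by_contra hne
  have h2 := hH.le_of_ge ⟨hH.prop.1.trans le_sup_left, lt_of_le_of_ne h1 hne⟩ le_sup_left
  exact hzH (h2 (Submodule.mem_sup_right (Submodule.mem_span_singleton_self z)))

theorem sz_eq_sz_inf_add_one {H W U : Submodule k[X] M} {z : M} (hz : z ∈ soc k M)
    (hzH : z ∉ H) (hWs : W ≤ soc k M) (hW : H ⊔ Submodule.span k[X] {z} = W) (hU : U ≤ W)
    (hUH : ¬ U ≤ H) : sz k U = sz k (U ⊓ H : Submodule k[X] M) + 1 := by
  obtain ⟨h, hh, hzU⟩ := exists_add_mem hz hW hU hUH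
  conv_lhs => rw [← inf_sup_span hz hW hU hh hzU]
  refine sz_sup_span (hWs (hU hzU)) fun h' => hzH ?_
  simpa using H.sub_mem h'.2 hh

/-- Every such U is U' + ⟨z + h⟩ for some h in H, and h is unique modulo U'. Hence the map from H to
the extensions has all fibres of size |U'|. -/
theorem card_extensions {H W U' : Submodule k[X] M} {z : M} (hz : z ∈ soc k M)
    (hzH : z ∉ H) (hWs : W ≤ soc k M) (hW : H ⊔ Submodule.span k[X] {z} = W) (hU' : U' ≤ H) :
    Nat.card {U : Submodule k[X] M // U ≤ W ∧ U ⊓ H = U' ∧ ¬ U ≤ H} * Nat.card U' =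
      Nat.card H := by
  set S := {U : Submodule k[X] M // U ≤ W ∧ U ⊓ H = U' ∧ ¬ U ≤ H} with hS
  have hzW : z ∈ W := hW ▸ Submodule.mem_sup_right (Submodule.mem_span_singleton_self z)
  have hHW : H ≤ W := hW ▸ le_sup_left
  have hn : ∀ h ∈ H, z + h ∉ H := fun h hh h' => hzH (by simpa using H.sub_mem h' hh)
  have hs : ∀ h ∈ H, z + h ∈ soc k M := fun h hh => hWs (W.add_mem hzW (hHW hh))
  let π : H → S := fun h => ⟨U' ⊔ Submodule.span k[X] {z + h.1},
    sup_le (hU'.trans hHW) ((Submodule.span_singleton_le_iff_mem _ _).2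
      (W.add_mem hzW (hHW h.2))),
    sup_span_inf (hs _ h.2) (hn _ h.2) hU',
    fun h' => hn _ h.2 (h' (Submodule.mem_sup_right (Submodule.mem_span_singleton_self _)))⟩
  have hπ : ∀ (h : H) (U : S), π h = U ↔ z + h.1 ∈ U.1 := by
    intro h U
    constructor
    · rintro rfl
      exact Submodule.mem_sup_right (Submodule.mem_span_singleton_self _)
    · intro h'
      apply Subtype.ext
      rw [← inf_sup_span hz hW U.2.1 h.2 h', U.2.2.1]
  have hne : ∀ U : S, ∃ h : H, z + h.1 ∈ U.1 := fun U => by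
    obtain ⟨h, hh, hU⟩ := exists_add_mem hz hW U.2.1 U.2.2.2
    exact ⟨⟨h, hh⟩, hU⟩
  choose σ hσ using hne
  have hle : ∀ U : S, U' ≤ U.1 := fun U => U.2.2.1.ge.trans inf_le_left
  let e : ∀ U : S, {h : H // π h = U} ≃ U' := fun U =>
    { toFun := fun h => ⟨h.1.1 - (σ U).1, by
        rw [← U.2.2.1]
        refine ⟨?_, H.sub_mem h.1.2 (σ U).2⟩
        simpa using U.1.sub_mem ((hπ _ _).1 h.2) (hσ U)⟩
      invFun := fun u => ⟨⟨(σ U).1 + u.1, H.add_mem (σ U).2 (hU' u.2)⟩, by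
        rw [hπ, ← add_assoc]
        exact U.1.add_mem (hσ U) (hle U u.2)⟩
      left_inv := fun h => by ext; simp
      right_inv := fun u => by ext; simp }
  rw [← Nat.card_prod]
  exact Nat.card_congr ((Equiv.sigmaEquivProdOfEquiv e).symm.trans (Equiv.sigmaFiberEquiv π))

end

/-! ### Counting subspaces in given position to a flag. -/

theorem natCard_subtype_split {α : Type} [Finite α] (p r : α → Prop) :
    Nat.card {x // p x} = Nat.card {x // p x ∧ r x} + Nat.card {x // p x ∧ ¬ r x} := by
  classical
  have := Fintype.ofFinite α
  simp only [Nat.card_eq_fintype_card, Fintype.card_subtype]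
  rw [← Finset.card_filter_add_card_filter_not (s := Finset.univ.filter p) r,
    Finset.filter_filter, Finset.filter_filter]

theorem natCard_eq_card_mul_of_fiber {α β : Type} [Finite α] [Finite β] (f : α → β) {n : ℕ}
    (h : ∀ b, Nat.card {a // f a = b} = n) : Nat.card α = Nat.card β * n := by
  have := Fintype.ofFinite β
  rw [← Nat.card_congr (Equiv.sigmaFiberEquiv f), Nat.card_sigma, Finset.sum_congr rfl
    (fun b _ => h b), Finset.sum_const, Finset.card_univ, Nat.card_eq_fintype_card, smul_eq_mul]

/-- The number of subspaces `U` with given dimensions of the intersections with the members of a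
filtration is a polynomial in the number of elements of the field. -/
theorem exists_flag_polynomial (n : ℕ) : ∀ d e : ℕ → ℕ, d 0 = n → (∃ N, d N = 0) →
    ∃ P : ℤ[X], ∀ (k : Type) [Field k] [Finite k] (M : Type) [AddCommGroup M] [Module k[X] M]
      [Finite M] (W : ℕ → Submodule k[X] M), Antitone W → W 0 ≤ soc k M →
      (∀ j, sz k (W j) = d j) →
      P.eval (Nat.card k : ℤ) = (Nat.card {U : Submodule k[X] M //
        U ≤ W 0 ∧ ∀ j, sz k (U ⊓ W j : Submodule k[X] M) = e j} : ℕ) := by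
  classical
  induction n with
  | zero =>
    intro d e h0 _
    refine ⟨if ∀ j, e j = 0 then 1 else 0, fun k _ _ M _ _ _ W hW hs hd => ?_⟩
    have hW0 : W 0 = ⊥ := by rw [← sz_eq_zero_iff (k := k), hd, h0]
    have hU : ∀ U : Submodule k[X] M, (U ≤ W 0 ∧ ∀ j, sz k (U ⊓ W j : Submodule k[X] M) = e j) ↔
        U = ⊥ ∧ ∀ j, e j = 0 := by
      intro U
      rw [hW0, le_bot_iff]
      refine and_congr_right fun h => forall_congr' fun j => ?_
      rw [h, bot_inf_eq, sz_eq_zero_iff.2 rfl, eq_comm]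
    simp only [hU]
    split_ifs with h
    · simp [h]
    · simp [h]
  | succ n ih =>
    intro d e h0 hN
    -- The index m is the last before the first drop of the flag. A hyperplane H of W 0 containing W
    -- (m + 1) meets W j in H for j ≤ m and contains W j for j > m.
    have hex : ∃ m, (∀ j ≤ m, d j = d 0) ∧ d (m + 1) ≠ d 0 := by
      have hN' : ∃ N, d N ≠ d 0 := by
        obtain ⟨N, hN⟩ := hN
        exact ⟨N, by omega⟩
      have h1 := Nat.find_spec hN'
      have h2 : Nat.find hN' ≠ 0 := fun h => h1 (by rw [h])
      obtain ⟨m, hm⟩ := Nat.exists_eq_succ_of_ne_zero h2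
      refine ⟨m, fun j hj => ?_, ?_⟩
      · exact not_not.1 (Nat.find_min hN' (m := j) (by omega))
      · rwa [hm] at h1
    obtain ⟨m, hm, hm1⟩ := hex
    set d' : ℕ → ℕ := fun j => if j ≤ m then d j - 1 else d j with hd'
    set e' : ℕ → ℕ := fun j => if j ≤ m then e j - 1 else e j with he'
    have hd0 : d' 0 = n := by simp [hd', h0]
    have hdN : ∃ N, d' N = 0 := by
      obtain ⟨N, hN⟩ := hN
      exact ⟨N, by simp only [hd', hN]; simp⟩
    obtain ⟨P, hP⟩ := ih d' e hd0 hdN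
    obtain ⟨Q, hQ⟩ := ih d' e' hd0 hdN
    -- P counts the U inside H. Any other U loses one dimension on intersecting with H, exactly at
    -- the indices j ≤ m; Q counts the possible U ∩ H, each with |H| / |U ∩ H| extensions. The side
    -- condition guards against truncation in `e j - 1`.
    refine ⟨P + if ∀ j ≤ m, 1 ≤ e j then Polynomial.X ^ (n - e' 0) * Q else 0,
      fun k _ _ M _ _ _ W hW hs hd => ?_⟩
    have hWm : ∀ j ≤ m, W j = W 0 := fun j hj =>
      eq_of_le_of_sz_le (k := k) (hW (Nat.zero_le j)) (by rw [hd, hd, hm j hj])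
    have hlt : W (m + 1) < W 0 := lt_of_le_of_ne (hW (Nat.zero_le _)) fun h => hm1 (by
      rw [← hd, h, hd])
    obtain ⟨H, z, hLH, hzW, hzH, hHz⟩ := exists_hyperplane hlt
    have hz := hs hzW
    have hHW : H ≤ W 0 := hHz ▸ le_sup_left
    have hszH : sz k H = n := by
      have := sz_sup_span hz hzH
      rw [hHz, hd, h0] at this
      omega
    have hWH : ∀ j, m < j → W j ≤ H := fun j hj => (hW (by omega : m + 1 ≤ j)).trans hLH
    have hWH' : ∀ j ≤ m, W j ⊓ H = H := fun j hj => by rw [hWm j hj]; exact inf_eq_right.2 hHW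
    have hWd : ∀ j, sz k (W j ⊓ H : Submodule k[X] M) = d' j := by
      intro j
      simp only [hd']
      split_ifs with hj
      · rw [hWH' j hj, hszH, hm j hj]; omega
      · rw [inf_eq_left.2 (hWH j (by omega)), hd]
    have hanti : Antitone fun j => W j ⊓ H := fun i j hij => inf_le_inf_right _ (hW hij)
    have hWH0 : W 0 ⊓ H = H := hWH' 0 (Nat.zero_le m)
    have h1 := hP k M (fun j => W j ⊓ H) hanti (inf_le_left.trans hs) hWd
    have h2 := hQ k M (fun j => W j ⊓ H) hanti (inf_le_left.trans hs) hWd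
    rw [natCard_subtype_split _ fun U => U ≤ H, Polynomial.eval_add, Nat.cast_add]
    congr 1
    · rw [h1]
      congr 1
      refine Nat.card_congr (Equiv.subtypeEquivRight fun U => ?_)
      rw [hWH0]
      constructor
      · rintro ⟨hU, h⟩
        refine ⟨⟨hU.trans hHW, fun j => ?_⟩, hU⟩
        rw [← h, inf_comm (W j), ← inf_assoc, inf_eq_left.2 hU]
      · rintro ⟨⟨_, h⟩, hU⟩
        refine ⟨hU, fun j => ?_⟩
        rw [← h, inf_comm (W j), ← inf_assoc, inf_eq_left.2 hU]
    have key : ∀ U : Submodule k[X] M, U ≤ W 0 → ¬ U ≤ H →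
        ((∀ j, sz k (U ⊓ W j : Submodule k[X] M) = e j) ↔ (∀ j ≤ m, 1 ≤ e j) ∧
          ∀ j, sz k ((U ⊓ H) ⊓ (W j ⊓ H) : Submodule k[X] M) = e' j) := by
      intro U hU hUH
      have hsz := sz_eq_sz_inf_add_one hz hzH hs hHz hU hUH
      have a1 : ∀ j ≤ m, U ⊓ W j = U := fun j hj => inf_eq_left.2 (by rwa [hWm j hj])
      have a2 : ∀ j ≤ m, (U ⊓ H) ⊓ (W j ⊓ H) = U ⊓ H := fun j hj => by
        rw [hWH' j hj, inf_assoc, inf_idem]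
      have a3 : ∀ j, m < j → (U ⊓ H) ⊓ (W j ⊓ H) = U ⊓ W j := fun j hj => by
        rw [inf_eq_left.2 (hWH j hj), inf_assoc, inf_eq_right.2 (hWH j hj)]
      constructor
      · intro h
        refine ⟨fun j hj => ?_, fun j => ?_⟩
        · rw [← h j, a1 j hj, hsz]; omega
        · by_cases hj : j ≤ m
          · have := h j
            rw [a1 j hj, hsz] at this
            simp only [he', if_pos hj]
            rw [a2 j hj]; omega
          · simp only [he', if_neg hj]
            rw [a3 j (by omega), h]
      · rintro ⟨h1, h2⟩ j
        have := h2 j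
        by_cases hj : j ≤ m
        · have h3 := h1 j hj
          simp only [he', if_pos hj] at this
          rw [a2 j hj] at this
          rw [a1 j hj]; omega
        · simp only [he', if_neg hj] at this
          rw [a3 j (by omega)] at this
          exact this
    split_ifs with he
    · rw [Polynomial.eval_mul, h2, Polynomial.eval_pow, Polynomial.eval_X]
      set T := {U : Submodule k[X] M //
        U ≤ W 0 ⊓ H ∧ ∀ j, sz k (U ⊓ (W j ⊓ H) : Submodule k[X] M) = e' j} with hT
      set S := {U : Submodule k[X] M // (U ≤ W 0 ∧
        ∀ j, sz k (U ⊓ W j : Submodule k[X] M) = e j) ∧ ¬ U ≤ H} with hS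
      let f : S → T := fun U => ⟨U.1 ⊓ H, inf_le_inf_right _ U.2.1.1,
        ((key U.1 U.2.1.1 U.2.2).1 U.2.1.2).2⟩
      have hf : ∀ b : T, Nat.card {a : S // f a = b} = Nat.card k ^ (n - e' 0) := by
        intro b
        have hbH : b.1 ≤ H := b.2.1.trans inf_le_right
        have hb : sz k b.1 = e' 0 := by
          rw [← b.2.2 0, inf_eq_left.2 b.2.1]
        have h3 := card_extensions hz hzH hs hHz hbH
        have h4 : Nat.card {a : S // f a = b} =
            Nat.card {U : Submodule k[X] M // U ≤ W 0 ∧ U ⊓ H = b.1 ∧ ¬ U ≤ H} := by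
          refine Nat.card_congr ⟨fun a => ⟨a.1.1, a.1.2.1.1, congrArg Subtype.val a.2, a.1.2.2⟩,
            fun U => ⟨⟨U.1, ⟨U.2.1, (key U.1 U.2.1 U.2.2.2).2 ⟨he, fun j => ?_⟩⟩, U.2.2.2⟩,
              Subtype.ext U.2.2.1⟩, fun _ => rfl, fun _ => rfl⟩
          rw [U.2.2.1]
          exact b.2.2 j
        have hle : e' 0 ≤ n := by
          rw [← hb, ← hszH]; exact sz_mono hbH
        rw [h4]
        rw [card_eq_pow_sz (k := k) b.1, card_eq_pow_sz (k := k) H, hb, hszH] at h3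
        have h5 : 0 < Nat.card k ^ e' 0 := pow_pos (by have := one_lt_card (k := k); omega) _
        refine Nat.eq_of_mul_eq_mul_right h5 ?_
        rw [h3, ← pow_add, Nat.sub_add_cancel hle]
      have := natCard_eq_card_mul_of_fiber f hf
      rw [this]
      push_cast
      ring
    · have : IsEmpty {U : Submodule k[X] M // (U ≤ W 0 ∧
          ∀ j, sz k (U ⊓ W j : Submodule k[X] M) = e j) ∧ ¬ U ≤ H} :=
        ⟨fun U => he ((key U.1 U.2.1.1 U.2.2).1 U.2.1.2).1⟩
      rw [Polynomial.eval_zero, @Nat.card_of_isEmpty _ this, Nat.cast_zero]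

/-! ### Hall numbers and chains of submodules. -/

section

variable {k : Type} [Field k]
variable {M N : Type} [AddCommGroup M] [Module k[X] M] [AddCommGroup N] [Module k[X] N]

/-- The number of submodules `U` of `M` of type `m` with `M / U` of type `l`. -/
def hallCount (k : Type) [Field k] (M : Type) [AddCommGroup M] [Module k[X] M] (l m : Ptn) : ℕ :=
  Nat.card {U : Submodule k[X] M // HasType k U m ∧ HasType k (M ⧸ U) l}

theorem hallNumber_eq_hallCount (l m x : Ptn) :
    hallNumber k l m x = hallCount k (Nilp k x) l m := rfl

theorem hallCount_congr (e : M ≃ₗ[k[X]] N) (l m : Ptn) :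
    hallCount k M l m = hallCount k N l m := by
  refine Nat.card_congr ((Submodule.orderIsoMapComap e).toEquiv.subtypeEquiv fun U => ?_)
  exact and_congr (hasType_congr (e.submoduleMap U))
    (hasType_congr (Submodule.Quotient.equiv U (U.map (e : M →ₗ[k[X]] N)) e rfl))

theorem HasType.hallCount_eq {x : Ptn} (h : HasType k M x) (l m : Ptn) :
    hallCount k M l m = hallNumber k l m x :=
  hallCount_congr h.some l m

/-- The number of chains `U₁ ≤ U₂ ≤ M` with given types of the successive quotients. -/
def chainCount (k : Type) [Field k] (M : Type) [AddCommGroup M] [Module k[X] M]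
    (l a b : Ptn) : ℕ :=
  Nat.card {p : Submodule k[X] M × Submodule k[X] M // p.1 ≤ p.2 ∧ HasType k p.1 b ∧
    HasType k (p.2 ⧸ p.1.submoduleOf p.2) a ∧ HasType k (M ⧸ p.2) l}

theorem hasType_comap_mkQ (U : Submodule k[X] M) (V : Submodule k[X] (M ⧸ U)) (l : Ptn) :
    HasType k (M ⧸ V.comap U.mkQ) l ↔ HasType k ((M ⧸ U) ⧸ V) l := by
  refine hasType_congr (Submodule.quotEquivOfEq _ _ ?_ ≪≫ₗ
    LinearMap.quotKerEquivOfSurjective (V.mkQ ∘ₗ U.mkQ)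
      (V.mkQ_surjective.comp U.mkQ_surjective))
  rw [LinearMap.ker_comp, Submodule.ker_mkQ]

theorem hasType_comap_mkQ_quotient (U : Submodule k[X] M) (V : Submodule k[X] (M ⧸ U))
    (l : Ptn) :
    HasType k (V.comap U.mkQ ⧸ U.submoduleOf (V.comap U.mkQ)) l ↔ HasType k V l := by
  let f : V.comap U.mkQ →ₗ[k[X]] V := U.mkQ.restrict fun x hx => hx
  have hf : Function.Surjective f := by
    rintro ⟨y, hy⟩
    obtain ⟨x, rfl⟩ := U.mkQ_surjective y
    exact ⟨⟨x, hy⟩, rfl⟩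
  refine hasType_congr (Submodule.quotEquivOfEq _ _ ?_ ≪≫ₗ
    LinearMap.quotKerEquivOfSurjective f hf)
  ext x
  rw [LinearMap.mem_ker, Subtype.ext_iff]
  exact (Submodule.Quotient.mk_eq_zero U).symm

theorem hasType_map_subtype (U : Submodule k[X] M) (V : Submodule k[X] U) (l : Ptn) :
    HasType k (V.map U.subtype) l ↔ HasType k V l :=
  hasType_congr (Submodule.equivSubtypeMap U V).symm

theorem submoduleOf_map_subtype (U : Submodule k[X] M) (V : Submodule k[X] U) :
    (V.map U.subtype).submoduleOf U = V :=
  Submodule.comap_map_eq_of_injective U.injective_subtype V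

variable [Finite k] [Finite M]

theorem hallCount_eq_zero {l m : Ptn} (h : sz k M ≠ l.1 + m.1) : hallCount k M l m = 0 := by
  have : IsEmpty {U : Submodule k[X] M // HasType k U m ∧ HasType k (M ⧸ U) l} := by
    refine ⟨fun U => h ?_⟩
    rw [← sz_add_sz_quotient U.1, U.2.1.sz_eq, U.2.2.sz_eq, add_comm]
  exact Nat.card_of_isEmpty

theorem sz_nilp (l : Ptn) : sz k (Nilp k l) = l.1 := by
  rw [← rk_zero, rk_nilp, prk_zero]

theorem hallNumber_eq_zero {l m x : Ptn} (h : x.1 ≠ l.1 + m.1) : hallNumber k l m x = 0 :=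
  hallCount_eq_zero (by rwa [sz_nilp])

open Classical in
theorem hallCount_eq_sum (hM : IsNilp k M) (l m : Ptn) :
    hallCount k M l m = ∑ x : (l.1 + m.1).Partition,
      if HasType k M ⟨_, x⟩ then hallNumber k l m ⟨_, x⟩ else 0 := by
  obtain ⟨⟨n, y⟩, hy⟩ := exists_hasType hM
  by_cases h : n = l.1 + m.1
  · subst h
    rw [Finset.sum_eq_single y, if_pos hy, hy.hallCount_eq]
    · intro z _ hz
      rw [if_neg fun h => hz ?_]
      simpa using h.unique hy
    · simp
  · rw [hallCount_eq_zero, Finset.sum_eq_zero]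
    · intro z _
      rw [if_neg fun h' => h ?_]
      exact hy.sz_eq.symm.trans h'.sz_eq
    · rwa [hy.sz_eq]

theorem sum_sum_ite {α I : Type} [Finite α] [Fintype I] (p : α → Prop)
    (r : I → α → Prop) [∀ i a, Decidable (r i a)] [Fintype {a // p a}] (c : I → ℕ) :
    ∑ a : {a // p a}, ∑ i, (if r i a.1 then c i else 0) =
      ∑ i, c i * Nat.card {a // p a ∧ r i a} := by
  classical
  have := Fintype.ofFinite α
  rw [Finset.sum_comm]
  refine Finset.sum_congr rfl fun i _ => ?_
  rw [← Finset.sum_filter, Finset.sum_const, smul_eq_mul, mul_comm]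
  congr 1
  rw [← Fintype.card_subtype, ← Nat.card_eq_fintype_card]
  exact Nat.card_congr (Equiv.subtypeSubtypeEquivSubtypeInter p fun a => r i a)

/-- Choose U₁ first; then U₂ amounts to a submodule of M/U₁, and the U₁ are sorted by the type of
M/U₁. -/
theorem chainCount_eq_sum_quotient (hM : IsNilp k M) (l a b : Ptn) :
    chainCount k M l a b = ∑ x : (l.1 + a.1).Partition,
      hallNumber k l a ⟨_, x⟩ * hallCount k M ⟨_, x⟩ b := by
  classical
  have := Fintype.ofFinite {U : Submodule k[X] M // HasType k U b}
  have h1 : chainCount k M l a b = Nat.card ((U : {U : Submodule k[X] M // HasType k U b}) ×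
      {V : Submodule k[X] (M ⧸ U.1) // HasType k V a ∧ HasType k ((M ⧸ U.1) ⧸ V) l}) := by
    symm
    refine Nat.card_congr (Equiv.ofBijective (fun s => ⟨(s.1.1, s.2.1.comap s.1.1.mkQ),
      ?_, s.1.2, (hasType_comap_mkQ_quotient _ _ _).2 s.2.2.1,
        (hasType_comap_mkQ _ _ _).2 s.2.2.2⟩) ⟨?_, ?_⟩)
    · exact Submodule.le_comap_mkQ _ _
    · rintro ⟨⟨U, hU⟩, ⟨V, hV⟩⟩ ⟨⟨U', hU'⟩, ⟨V', hV'⟩⟩ h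
      have h1 : U = U' := congrArg (fun p => p.1.1) h
      subst h1
      have h2 : V.comap U.mkQ = V'.comap U.mkQ := congrArg (fun p => p.1.2) h
      have h3 := Submodule.comap_injective_of_surjective U.mkQ_surjective h2
      subst h3
      rfl
    · rintro ⟨⟨U, U'⟩, h, h1, h2, h3⟩
      dsimp only at h h1 h2 h3
      have h4 : (U'.map U.mkQ).comap U.mkQ = U' := by
        rw [Submodule.comap_map_mkQ, sup_eq_right.2 h]
      refine ⟨⟨⟨U, h1⟩, ⟨U'.map U.mkQ, ?_, ?_⟩⟩, ?_⟩
      · rw [← hasType_comap_mkQ_quotient, h4]; exact h2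
      · rw [← hasType_comap_mkQ, h4]; exact h3
      · exact Subtype.ext (Prod.ext rfl h4)
  rw [h1, Nat.card_sigma]
  refine (Finset.sum_congr rfl fun U _ => hallCount_eq_sum (hM.quotient U.1) l a).trans ?_
  exact sum_sum_ite (fun U : Submodule k[X] M => HasType k U b)
    (fun (x : (l.1 + a.1).Partition) U => HasType k (M ⧸ U) ⟨_, x⟩)
    fun x => hallNumber k l a ⟨_, x⟩

/-- Choose U₂ first; then U₁ is a submodule of U₂, and the U₂ are sorted by their type. -/
theorem chainCount_eq_sum_submodule (hM : IsNilp k M) (l a b : Ptn) :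
    chainCount k M l a b = ∑ x : (a.1 + b.1).Partition,
      hallNumber k a b ⟨_, x⟩ * hallCount k M l ⟨_, x⟩ := by
  classical
  have := Fintype.ofFinite {U : Submodule k[X] M // HasType k (M ⧸ U) l}
  have h1 : chainCount k M l a b =
      Nat.card ((U : {U : Submodule k[X] M // HasType k (M ⧸ U) l}) ×
      {V : Submodule k[X] U.1 // HasType k V b ∧ HasType k (U.1 ⧸ V) a}) := by
    symm
    refine Nat.card_congr (Equiv.ofBijective (fun s => ⟨(s.2.1.map s.1.1.subtype, s.1.1),
      ?_, (hasType_map_subtype _ _ _).2 s.2.2.1, ?_, s.1.2⟩) ⟨?_, ?_⟩)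
    · exact Submodule.map_subtype_le _ _
    · rw [submoduleOf_map_subtype]; exact s.2.2.2
    · rintro ⟨⟨U, hU⟩, ⟨V, hV⟩⟩ ⟨⟨U', hU'⟩, ⟨V', hV'⟩⟩ h
      have h1 : U = U' := congrArg (fun p => p.1.2) h
      subst h1
      have h2 : V.map U.subtype = V'.map U.subtype := congrArg (fun p => p.1.1) h
      have h3 := Submodule.map_injective_of_injective U.injective_subtype h2
      subst h3
      rfl
    · rintro ⟨⟨V, U⟩, h, h1, h2, h3⟩
      dsimp only at h h1 h2 h3
      have h4 : (V.submoduleOf U).map U.subtype = V := by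
        rw [Submodule.submoduleOf, Submodule.map_comap_subtype, inf_eq_right.2 h]
      refine ⟨⟨⟨U, h3⟩, ⟨V.submoduleOf U, ?_, h2⟩⟩, ?_⟩
      · rw [← hasType_map_subtype, h4]; exact h1
      · exact Subtype.ext (Prod.ext h4 rfl)
  rw [h1, Nat.card_sigma]
  refine (Finset.sum_congr rfl fun U _ => hallCount_eq_sum (hM.submodule U.1) a b).trans ?_
  refine (sum_sum_ite (fun U : Submodule k[X] M => HasType k (M ⧸ U) l)
    (fun (x : (a.1 + b.1).Partition) (U : Submodule k[X] M) => HasType k U ⟨_, x⟩)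
    fun x => hallNumber k a b ⟨_, x⟩).trans (Finset.sum_congr rfl fun x _ => ?_)
  simp only [hallCount, and_comm]

theorem hallNumber_assoc (l a b x : Ptn) :
    ∑ y : (l.1 + a.1).Partition, hallNumber k l a ⟨_, y⟩ * hallNumber k ⟨_, y⟩ b x =
      ∑ y : (a.1 + b.1).Partition, hallNumber k a b ⟨_, y⟩ * hallNumber k l ⟨_, y⟩ x :=
  (chainCount_eq_sum_quotient (isNilp_nilp x) l a b).symm.trans
    (chainCount_eq_sum_submodule (isNilp_nilp x) l a b)

end

/-! ### Hall polynomials -/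

theorem prk_anti (l : Ptn) {i j : ℕ} (h : i ≤ j) : prk j l ≤ prk i l :=
  Multiset.sum_map_le_sum_map _ _ fun a _ => by omega

theorem prk_eq_zero (l : Ptn) : prk l.1 l = 0 := by
  rw [prk, Multiset.sum_eq_zero]
  intro a ha
  obtain ⟨b, hb, rfl⟩ := Multiset.mem_map.1 ha
  have := l.2.le_of_mem_parts hb
  omega

theorem prk_one_lt {l : Ptn} (h : l.1 ≠ 0) : prk 1 l < prk 0 l := by
  refine Multiset.sum_lt_sum_of_nonempty ?_ fun a ha => ?_
  · intro h0
    have := l.2.parts_sum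
    rw [h0] at this
    exact h this.symm
  · have := l.2.parts_pos ha
    omega

/-- The partition `(1, …, 1)`. -/
def ones (r : ℕ) : Ptn := ofMS (Multiset.replicate r 1)

theorem prk_ones (r j : ℕ) : prk j (ones r) = r * (1 - j) := by
  simp [ones, prk_ofMS]

theorem ones_fst (r : ℕ) : (ones r).1 = r := by
  rw [← prk_zero, prk_ones]; simp

/-- The partition obtained by decreasing all parts by one. -/
def dec (l : Ptn) : Ptn := ofMS (l.2.parts.map (· - 1))

theorem prk_dec (l : Ptn) (j : ℕ) : prk j (dec l) = prk (j + 1) l := by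
  rw [dec, prk_ofMS, prk, Multiset.map_map]
  congr 2
  funext a
  simp only [Function.comp_apply]
  omega

theorem dec_fst (l : Ptn) : (dec l).1 = prk 1 l := by
  rw [← prk_zero, prk_dec]

section

variable {k : Type} [Field k] [Finite k]
variable {M : Type} [AddCommGroup M] [Module k[X] M] [Finite M]

theorem hasType_ones_iff (hM : IsNilp k M) (U : Submodule k[X] M) (r : ℕ) :
    HasType k U (ones r) ↔ U ≤ soc k M ∧ sz k U = r := by
  rw [hasType_iff (hM.submodule U)]
  constructor
  · intro h
    refine ⟨fun x hx => ?_, by rw [← rk_zero, h, prk_ones]; simp⟩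
    have h1 := h 1
    rw [prk_ones, Nat.sub_self, mul_zero, rk_submodule, sz_eq_zero_iff, eq_bot_iff] at h1
    exact h1 (Submodule.mem_map_of_mem hx)
  · rintro ⟨h, h'⟩ j
    rw [prk_ones]
    cases j with
    | zero => rw [rk_zero, h']; simp
    | succ j =>
      rw [rk_submodule, show r * (1 - (j + 1)) = 0 by simp, sz_eq_zero_iff, eq_bot_iff]
      rintro _ ⟨x, hx, rfl⟩
      rw [Submodule.mem_bot, LinearMap.lsmul_apply, pow_succ, mul_smul, mem_soc.1 (h hx),
        smul_zero]

/-- M modulo its socle is isomorphic to TM; on types this lowers every part by one. -/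
theorem rk_quotient_soc (j : ℕ) : rk k (M ⧸ soc k M) j = rk k M (j + 1) := by
  have h1 := rk_quotient_add (soc k M) j
  have h2 := sz_soc_inf_add (k := k) (M := M) j
  omega

theorem sz_soc_nilp (m : Ptn) : sz k (soc k (Nilp k m)) + prk 1 m = prk 0 m := by
  have h := sz_soc_add (k := k) (M := Nilp k m)
  rw [rk_nilp, sz_nilp] at h
  rw [prk_zero]
  exact h

/-- The socle of M_m has dimension `prk 0 m - prk 1 m`, so it is the only candidate. -/
theorem hallNumber_dec_ones_self (m : Ptn) :
    hallNumber k (dec m) (ones (prk 0 m - prk 1 m)) m = 1 := by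
  rw [hallNumber_eq_hallCount, hallCount]
  have hs := sz_soc_nilp (k := k) m
  have h : ∀ U : Submodule k[X] (Nilp k m),
      (HasType k U (ones (prk 0 m - prk 1 m)) ∧ HasType k (Nilp k m ⧸ U) (dec m)) ↔
        U = soc k (Nilp k m) := by
    intro U
    rw [hasType_ones_iff (isNilp_nilp m)]
    constructor
    · rintro ⟨⟨h1, h2⟩, _⟩
      exact eq_of_le_of_sz_le h1 (by omega)
    · rintro rfl
      refine ⟨⟨le_rfl, by omega⟩, (hasType_iff ((isNilp_nilp m).quotient _)).2 fun j => ?_⟩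
      rw [rk_quotient_soc, rk_nilp, prk_dec]
  simp only [h]
  simp

/-- This is the triangularity behind the induction. A submodule U that is counted lies in the socle
of M_n. Unless `prk 1 n` is smaller than `prk 1 m`, that socle is no larger than U, so U equals it;
the quotient and the size then determine n. -/
theorem eq_or_lt_of_hallNumber_ne_zero {m n : Ptn}
    (h : hallNumber k (dec m) (ones (prk 0 m - prk 1 m)) n ≠ 0) :
    n = m ∨ prk 1 n < prk 1 m := by
  have h0 : n.1 = m.1 := by
    by_contra hne
    refine h (hallNumber_eq_zero ?_)
    have := prk_anti m zero_le_one
    rw [dec_fst, ones_fst, Nat.add_sub_cancel' this, prk_zero]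
    exact hne
  rw [or_iff_not_imp_right, not_lt]
  intro hle
  have hne : Nonempty {U : Submodule k[X] (Nilp k n) //
      HasType k U (ones (prk 0 m - prk 1 m)) ∧ HasType k (Nilp k n ⧸ U) (dec m)} := by
    by_contra hE
    rw [not_nonempty_iff] at hE
    exact h (@Nat.card_of_isEmpty _ hE)
  obtain ⟨U, h1, h2⟩ := hne
  obtain ⟨h3, h4⟩ := (hasType_ones_iff (isNilp_nilp n) U _).1 h1
  have hs := sz_soc_nilp (k := k) n
  have h5 : prk 0 n = prk 0 m := by rw [prk_zero, prk_zero, h0]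
  have h6 : U = soc k (Nilp k n) := eq_of_le_of_sz_le h3 (by omega)
  refine prk_injective fun j => ?_
  cases j with
  | zero => exact h5
  | succ j => rw [← prk_dec m, ← h2.rk_eq, h6, rk_quotient_soc, rk_nilp]

theorem hallNumber_of_fst_eq_zero {m : Ptn} (hm : m.1 = 0) (l x : Ptn) [Decidable (l = x)] :
    hallNumber k l m x = if l = x then 1 else 0 := by
  rw [hallNumber_eq_hallCount, hallCount]
  have hm0 : ∀ j, prk j m = 0 := fun j => by
    have := prk_anti m (Nat.zero_le j)
    rw [prk_zero] at this
    omega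
  have h : ∀ U : Submodule k[X] (Nilp k x),
      (HasType k U m ∧ HasType k (Nilp k x ⧸ U) l) ↔ U = ⊥ ∧ l = x := by
    intro U
    constructor
    · rintro ⟨h1, h2⟩
      have hU : U = ⊥ := sz_eq_zero_iff.1 (h1.sz_eq.trans hm)
      refine ⟨hU, ?_⟩
      subst hU
      exact ((hasType_congr (Submodule.quotEquivOfEqBot ⊥ rfl)).1 h2).unique
        ⟨LinearEquiv.refl _ _⟩
    · rintro ⟨rfl, rfl⟩
      refine ⟨(hasType_iff ((isNilp_nilp l).submodule _)).2 fun j => ?_,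
        ⟨Submodule.quotEquivOfEqBot ⊥ rfl⟩⟩
      rw [hm0, rk_submodule, Submodule.map_bot, sz_eq_zero_iff]
  simp only [h]
  split_ifs with hl
  · simp [hl]
  · simp [hl]

end

/-- For U in the socle, M_x/U has type l exactly when each U ∩ T^j M_x has dimension `prk j x - prk
j l`: a flag condition for the subspaces soc ∩ T^j M_x. If these differences are negative, or the
sizes do not match, no U exists. -/
theorem exists_hallPolynomial_ones (l x : Ptn) (r : ℕ) :
    ∃ P, IsHallPolynomial l (ones r) x P := by
  by_cases hlx : (∀ j, prk j l ≤ prk j x) ∧ prk 0 x = prk 0 l + r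
  · obtain ⟨hle, h0⟩ := hlx
    obtain ⟨P, hP⟩ := exists_flag_polynomial _ (fun j => prk j x - prk (j + 1) x)
      (fun j => prk j x - prk j l) rfl ⟨x.1, by simp [prk_eq_zero x]⟩
    refine ⟨P, fun k _ _ => ?_⟩
    let W : ℕ → Submodule k[X] (Nilp k x) := fun j =>
      soc k (Nilp k x) ⊓ LinearMap.range (shiftMap k (Nilp k x) j)
    have hanti : Antitone W := by
      intro i j hij
      refine inf_le_inf_left _ ?_
      rintro _ ⟨y, rfl⟩
      refine ⟨(Polynomial.X : k[X]) ^ (j - i) • y, ?_⟩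
      simp only [LinearMap.lsmul_apply, smul_smul, ← pow_add, Nat.add_sub_cancel' hij]
    have hW0 : W 0 = soc k (Nilp k x) := by
      refine inf_eq_left.2 fun y _ => ⟨y, by simp⟩
    have hsz : ∀ j, sz k (W j) = prk j x - prk (j + 1) x := fun j => by
      have := sz_soc_inf_add (k := k) (M := Nilp k x) j
      rw [rk_nilp, rk_nilp] at this
      simp only [W]
      omega
    rw [hP k (Nilp k x) W hanti hW0.le hsz, hallNumber_eq_hallCount, hallCount]
    congr 1
    refine Nat.card_congr (Equiv.subtypeEquivRight fun U => ?_)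
    rw [hasType_ones_iff (isNilp_nilp x), hasType_iff ((isNilp_nilp x).quotient U), hW0]
    have hq := fun j => rk_quotient_add (k := k) U j
    have hUW : U ≤ soc k (Nilp k x) → ∀ j,
        U ⊓ W j = U ⊓ LinearMap.range (shiftMap k (Nilp k x) j) := fun hU j => by
      simp only [W]
      rw [← inf_assoc, inf_eq_left.2 hU]
    constructor
    · rintro ⟨hU, h⟩
      refine ⟨⟨hU, ?_⟩, fun j => ?_⟩
      · have := h 0
        rw [hW0, inf_eq_left.2 hU] at this
        omega
      · have h1 := h j
        rw [hUW hU] at h1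
        have h2 := hq j
        rw [h1, rk_nilp] at h2
        have := hle j
        omega
    · rintro ⟨⟨hU, _⟩, h⟩
      refine ⟨hU, fun j => ?_⟩
      have h2 := hq j
      rw [h, rk_nilp] at h2
      rw [hUW hU]
      omega
  · refine ⟨0, fun k _ _ => ?_⟩
    rw [Polynomial.eval_zero, hallNumber_eq_hallCount, hallCount, eq_comm, Nat.cast_eq_zero]
    have : IsEmpty {U : Submodule k[X] (Nilp k x) //
        HasType k U (ones r) ∧ HasType k (Nilp k x ⧸ U) l} := by
      refine ⟨fun U => hlx ⟨fun j => ?_, ?_⟩⟩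
      · rw [← U.2.2.rk_eq, ← rk_nilp (k := k) x, ← rk_quotient_add U.1 j]
        omega
      · have hs := sz_add_sz_quotient (k := k) U.1
        rw [U.2.2.sz_eq, U.2.1.sz_eq, ones_fst, sz_nilp] at hs
        rw [prk_zero, prk_zero, ← hs, add_comm]
    exact Nat.card_of_isEmpty

theorem exists_partition_eq {l : Ptn} {n : ℕ} (h : l.1 = n) :
    ∃ y : n.Partition, (⟨n, y⟩ : Ptn) = l := by
  subst h
  exact ⟨l.2, rfl⟩

/-- The existence of Hall polynomials. -/
theorem exists_isHallPolynomial (l m x : Ptn) : ∃ P, IsHallPolynomial l m x P := by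
  classical
  -- Passing to `dec m` lowers the measure since the size drops; the other terms of the product of
  -- `dec m` and (1^r) have the size of m but smaller `prk 1`.
  induction hN : prk 0 m + prk 1 m using Nat.strong_induction_on generalizing l m x with
  | _ N ih =>
  subst hN
  by_cases hm : m.1 = 0
  · refine ⟨if l = x then 1 else 0, fun k _ _ => ?_⟩
    rw [hallNumber_of_fst_eq_zero hm]
    split_ifs <;> simp
  have hlt := prk_one_lt hm
  set r := prk 0 m - prk 1 m with hr
  have hsum : m.1 = (dec m).1 + (ones r).1 := by
    rw [dec_fst, ones_fst, ← prk_zero]; omega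
  obtain ⟨y₀, hy₀⟩ := exists_partition_eq hsum
  have H1 : ∀ y : (l.1 + (dec m).1).Partition, ∃ P, IsHallPolynomial l (dec m) ⟨_, y⟩ P :=
    fun y => ih _ (by
      rw [prk_dec, prk_dec]
      have := prk_anti m (show 1 ≤ 1 + 1 by omega)
      simp only [Nat.zero_add]
      omega) _ _ _ rfl
  have H2 : ∀ y : (l.1 + (dec m).1).Partition, ∃ P, IsHallPolynomial ⟨_, y⟩ (ones r) x P :=
    fun y => exists_hallPolynomial_ones _ _ _
  have H3 : ∀ y : ((dec m).1 + (ones r).1).Partition,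
      ∃ P, IsHallPolynomial (dec m) (ones r) ⟨_, y⟩ P :=
    fun y => exists_hallPolynomial_ones _ _ _
  have H4 : ∀ y : ((dec m).1 + (ones r).1).Partition, ∃ P, prk 1 ⟨_, y⟩ < prk 1 m →
      IsHallPolynomial l ⟨_, y⟩ x P := fun y => by
    by_cases h : prk 1 ⟨_, y⟩ < prk 1 m
    · obtain ⟨P, hP⟩ := ih _ (by
        have := prk_zero ⟨_, y⟩
        have := prk_zero m
        dsimp only at *
        omega) l ⟨_, y⟩ x rfl
      exact ⟨P, fun _ => hP⟩
    · exact ⟨0, fun h' => absurd h' h⟩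
  choose P1 h1 using H1
  choose P2 h2 using H2
  choose P3 h3 using H3
  choose P4 h4 using H4
  -- Associativity for l, `dec m` and (1^r), solved for the term y₀ = m, whose coefficient is 1.
  refine ⟨∑ y, P1 y * P2 y - ∑ y ∈ Finset.univ.erase y₀,
    if prk 1 ⟨_, y⟩ < prk 1 m then P3 y * P4 y else 0, fun k _ _ => ?_⟩
  have hassoc := congrArg (Nat.cast (R := ℤ)) (hallNumber_assoc (k := k) l (dec m) (ones r) x)
  rw [← Finset.add_sum_erase _ _ (Finset.mem_univ y₀), hy₀, hallNumber_dec_ones_self,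
    one_mul] at hassoc
  push_cast at hassoc
  rw [Polynomial.eval_sub, Polynomial.eval_finsetSum, Polynomial.eval_finsetSum, sub_eq_iff_eq_add]
  rw [Finset.sum_congr rfl fun y _ => by
    rw [Polynomial.eval_mul, h1 y k, h2 y k], hassoc]
  refine congrArg (_ + ·) (Finset.sum_congr rfl fun y hy => ?_)
  split_ifs with hlt'
  · rw [Polynomial.eval_mul, h3 y k, h4 y hlt' k]
  · rw [Polynomial.eval_zero]
    by_contra hne
    have hne' : hallNumber k (dec m) (ones r) ⟨_, y⟩ ≠ 0 := by
      intro h0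
      rw [h0] at hne
      simp at hne
    rcases eq_or_lt_of_hallNumber_ne_zero hne' with h | h
    · have h' := h.trans hy₀.symm
      exact (Finset.mem_erase.1 hy).1 (by simpa using h')
    · exact hlt' h

theorem isHallPolynomial_hallPolynomial (l m x : Ptn) :
    IsHallPolynomial l m x (hallPolynomial l m x) := by
  rw [hallPolynomial, dif_pos (exists_isHallPolynomial l m x)]
  exact (exists_isHallPolynomial l m x).choose_spec

theorem eval_hallPolynomial (k : Type) [Field k] [Finite k] (l m x : Ptn) :
    (hallPolynomial l m x).eval (Nat.card k : ℤ) = hallNumber k l m x :=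
  isHallPolynomial_hallPolynomial l m x k

/-- A polynomial identity may be checked at the cardinalities of the finite fields. -/
theorem eq_of_eval_card_eq {P Q : ℤ[X]}
    (h : ∀ (k : Type) [Field k] [Finite k], P.eval (Nat.card k : ℤ) = Q.eval (Nat.card k : ℤ)) :
    P = Q := by
  refine Polynomial.eq_of_infinite_eval_eq P Q ?_
  have hinf : Set.Infinite ((fun n : ℕ => (n : ℤ)) '' {p : ℕ | p.Prime}) :=
    Nat.infinite_setOfPred_prime.image (fun a _ b _ h => Int.ofNat_inj.mp h)
  refine hinf.mono ?_
  rintro _ ⟨p, hp, rfl⟩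
  have : Fact p.Prime := ⟨hp⟩
  have h1 := h (ZMod p)
  rwa [Nat.card_zmod] at h1

theorem hallPolynomial_eq_zero {l m x : Ptn} (h : x.1 ≠ l.1 + m.1) :
    hallPolynomial l m x = 0 :=
  eq_of_eval_card_eq fun k _ _ => by
    rw [eval_hallPolynomial, hallNumber_eq_zero h]; simp

theorem hallPolynomial_assoc (l a b x : Ptn) :
    ∑ y : (l.1 + a.1).Partition, hallPolynomial l a ⟨_, y⟩ * hallPolynomial ⟨_, y⟩ b x =
      ∑ y : (a.1 + b.1).Partition, hallPolynomial a b ⟨_, y⟩ * hallPolynomial l ⟨_, y⟩ x :=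
  eq_of_eval_card_eq fun k _ _ => by
    simp only [Polynomial.eval_finsetSum, Polynomial.eval_mul, eval_hallPolynomial]
    exact_mod_cast hallNumber_assoc (k := k) l a b x

/-! ### Duality and the symmetry of Hall numbers. -/

section

variable {k : Type} [Field k]

/-- The functional on `k[T] / (T ^ a)` given by the coefficient of `T ^ (a - 1)`. -/
def topCoeff (k : Type) [Field k] (a : ℕ) : Cyc k a →ₗ[k] k :=
  Submodule.liftQ ((Ideal.span {(Polynomial.X : k[X]) ^ a}).restrictScalars k)
    -- The coefficient of T^a in T·g avoids the exponent a - 1 and is 0 when a = 0.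
    (Polynomial.lcoeff k a ∘ₗ LinearMap.mulLeft k (Polynomial.X : k[X]))
    (by
      intro g hg
      obtain ⟨h, rfl⟩ := Ideal.mem_span_singleton.1 hg
      rw [LinearMap.mem_ker, LinearMap.comp_apply, LinearMap.mulLeft_apply,
        Polynomial.lcoeff_apply, ← mul_assoc, ← pow_succ', Polynomial.coeff_X_pow_mul',
        if_neg (by omega)]) ∘ₗ
  (Submodule.Quotient.restrictScalarsEquiv k
    (Ideal.span {(Polynomial.X : k[X]) ^ a})).symm.toLinearMap

theorem topCoeff_mk (a : ℕ) (g : k[X]) :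
    topCoeff k a (Ideal.Quotient.mk _ g) = (Polynomial.X * g).coeff a := rfl

/-- A power of T moves a nonzero coefficient of x into degree a - 1. -/
theorem exists_topCoeff_mul_ne_zero {a : ℕ} {x : Cyc k a} (hx : x ≠ 0) :
    ∃ y : Cyc k a, topCoeff k a (x * y) ≠ 0 := by
  obtain ⟨g, rfl⟩ := Ideal.Quotient.mk_surjective x
  rw [ne_eq, Ideal.Quotient.eq_zero_iff_mem, Ideal.mem_span_singleton,
    Polynomial.X_pow_dvd_iff] at hx
  push Not at hx
  obtain ⟨m, hm, hg⟩ := hx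
  refine ⟨Ideal.Quotient.mk _ (Polynomial.X ^ (a - 1 - m)), ?_⟩
  rw [← map_mul, topCoeff_mk, mul_left_comm, ← pow_succ', Polynomial.coeff_mul_X_pow',
    if_pos (by omega)]
  rwa [show a - (a - 1 - m + 1) = m by omega]

/-- A symmetric non-degenerate form on `M_l` for which the variable is self-adjoint. -/
theorem exists_form (l : Ptn) : ∃ B : LinearMap.BilinForm k (Nilp k l),
    B.Nondegenerate ∧ (∀ x y, B x y = B y x) ∧
      ∀ (f : k[X]) (x y : Nilp k l), B (f • x) y = B x (f • y) := by
  classical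
  let B : LinearMap.BilinForm k (Nilp k l) := LinearMap.mk₂ k
    (fun x y => ∑ i : l.2.parts, topCoeff k i.1 (x i * y i))
    (fun x x' y => by simp only [Pi.add_apply, add_mul, map_add, Finset.sum_add_distrib])
    (fun c x y => by simp only [Pi.smul_apply, smul_mul_assoc, map_smul, Finset.smul_sum])
    (fun x y y' => by simp only [Pi.add_apply, mul_add, map_add, Finset.sum_add_distrib])
    (fun c x y => by simp only [Pi.smul_apply, mul_smul_comm, map_smul, Finset.smul_sum])
  have hB : ∀ x y, B x y = ∑ i : l.2.parts, topCoeff k i.1 (x i * y i) := fun x y => rfl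
  have hs : ∀ x y, B x y = B y x := fun x y => by simp only [hB, mul_comm]
  have hl : ∀ x : Nilp k l, (∀ y, B x y = 0) → x = 0 := by
    intro x hx
    by_contra hne
    obtain ⟨i, hi⟩ := Function.ne_iff.1 hne
    obtain ⟨y, hy⟩ := exists_topCoeff_mul_ne_zero hi
    refine hy ?_
    have := hx (Pi.single i y)
    rw [hB, Finset.sum_eq_single i] at this
    · rwa [Pi.single_eq_same] at this
    · intro j _ hj
      rw [Pi.single_eq_of_ne hj, mul_zero, map_zero]
    · simp
  refine ⟨B, ⟨hl, fun y hy => hl y fun x => by rw [hs, hy]⟩, hs, fun f x y => ?_⟩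
  rw [hB, hB]
  refine Finset.sum_congr rfl fun i _ => ?_
  rw [Pi.smul_apply, Pi.smul_apply, smul_mul_assoc, mul_smul_comm]

variable {M : Type} [AddCommGroup M] [Module k[X] M] [Module k M] [IsScalarTower k k[X] M]

/-- The orthogonal complement of a submodule. -/
def perp (B : LinearMap.BilinForm k M) (hf : ∀ (f : k[X]) (x y : M), B (f • x) y = B x (f • y))
    (U : Submodule k[X] M) : Submodule k[X] M where
  carrier := {x | ∀ y ∈ U, B y x = 0}
  add_mem' := fun {a b} ha hb y hy => by rw [map_add, ha y hy, hb y hy, add_zero]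
  zero_mem' := fun y _ => map_zero _
  smul_mem' := fun f x hx y hy => by rw [← hf]; exact hx _ (U.smul_mem f hy)

variable [Finite k] [Finite M] {B : LinearMap.BilinForm k M}
  (hf : ∀ (f : k[X]) (x y : M), B (f • x) y = B x (f • y))

theorem perp_restrictScalars (U : Submodule k[X] M) :
    (perp B hf U).restrictScalars k = B.orthogonal (U.restrictScalars k) := rfl

theorem perp_perp (hB : B.Nondegenerate) (hs : ∀ x y, B x y = B y x) (U : Submodule k[X] M) :
    perp B hf (perp B hf U) = U := by
  have hr : B.IsRefl := fun x y h => by rw [hs, h]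
  apply Submodule.restrictScalars_injective k
  rw [perp_restrictScalars, perp_restrictScalars, LinearMap.BilinForm.orthogonal_orthogonal hB hr]

theorem sz_eq_finrank (U : Submodule k[X] M) :
    sz k U = Module.finrank k (U.restrictScalars k) :=
  sz_eq_of_card_eq (Module.natCard_eq_pow_finrank (K := k) (V := U.restrictScalars k))

theorem sz_perp_add (hB : B.Nondegenerate) (U : Submodule k[X] M) :
    sz k (perp B hf U) + sz k U = sz k M := by
  have h := LinearMap.BilinForm.finrank_orthogonal hB (U.restrictScalars k)
  have h' := Submodule.finrank_le (U.restrictScalars k)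
  have h2 : sz k M = Module.finrank k M :=
    sz_eq_of_card_eq (Module.natCard_eq_pow_finrank (K := k) (V := M))
  rw [sz_eq_finrank, sz_eq_finrank, perp_restrictScalars, h, h2]
  omega

/-- As T is self-adjoint, the complement of T^j U^⊥ is the preimage of U under T^j; comparing
dimensions gives the claim. Thus U^⊥ has the type of M/U. -/
theorem rk_perp (hB : B.Nondegenerate) (hs : ∀ x y, B x y = B y x) (U : Submodule k[X] M)
    (j : ℕ) : rk k (perp B hf U) j = rk k (M ⧸ U) j := by
  have h1 : perp B hf ((perp B hf U).map (shiftMap k M j)) = U.comap (shiftMap k M j) := by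
    ext x
    rw [Submodule.mem_comap, LinearMap.lsmul_apply]
    conv_rhs => rw [← perp_perp hf hB hs U]
    constructor
    · intro h y hy
      rw [← hf]
      exact h _ ⟨y, hy, rfl⟩
    · rintro h _ ⟨y, hy, rfl⟩
      rw [LinearMap.lsmul_apply, hf]
      exact h y hy
  have h2 := sz_perp_add hf hB ((perp B hf U).map (shiftMap k M j))
  have h3 := sz_quotient_add_sz_comap (k := k) U j
  rw [h1] at h2
  rw [rk_submodule]
  omega

end

/-- The involution U ↦ U^⊥ exchanges the types of submodule and quotient. -/
theorem hallNumber_comm {k : Type} [Field k] [Finite k] (l m x : Ptn) :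
    hallNumber k l m x = hallNumber k m l x := by
  obtain ⟨B, hB, hs, hf⟩ := exists_form (k := k) x
  have hN := isNilp_nilp (k := k) x
  have h : ∀ (U : Submodule k[X] (Nilp k x)) (n : Ptn),
      HasType k (perp B hf U) n ↔ HasType k (Nilp k x ⧸ U) n := fun U n => by
    rw [hasType_iff (hN.submodule _), hasType_iff (hN.quotient _)]
    simp only [rk_perp hf hB hs]
  have h' : ∀ (U : Submodule k[X] (Nilp k x)) (n : Ptn),
      HasType k (Nilp k x ⧸ perp B hf U) n ↔ HasType k U n := fun U n => by
    rw [← h, perp_perp hf hB hs]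
  refine Nat.card_congr ((Function.Involutive.toPerm (perp B hf)
    (perp_perp hf hB hs)).subtypeEquiv fun U => ?_)
  exact and_comm.trans (and_congr (h U l).symm (h' U m).symm)

theorem hallPolynomial_comm (l m x : Ptn) : hallPolynomial l m x = hallPolynomial m l x :=
  eq_of_eval_card_eq fun k _ _ => by
    rw [eval_hallPolynomial, eval_hallPolynomial, hallNumber_comm]

/-! ### Cyclic submodules -/

section

variable {k : Type} [Field k]

theorem hasType_cyc (a : ℕ) : HasType k (Cyc k a) (row a) := by
  obtain ⟨e⟩ := pi_equiv_nilp (k := k) (fun _ : Unit => a)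
  exact ⟨(LinearEquiv.funUnique Unit k[X] (Cyc k a)).symm ≪≫ₗ e⟩

variable {M : Type} [AddCommGroup M] [Module k[X] M]

/-- The annihilator of x contains a power of T, hence is generated by one. -/
theorem exists_hasType_span (hM : IsNilp k M) (x : M) :
    ∃ a, HasType k (Submodule.span k[X] {x}) (row a) := by
  obtain ⟨n, hn⟩ := hM
  obtain ⟨g, hg⟩ := IsPrincipalIdealRing.principal (Ideal.torsionOf k[X] M x)
  have h1 : (Polynomial.X : k[X]) ^ n ∈ Ideal.torsionOf k[X] M x := hn x
  rw [hg, Ideal.submodule_span_eq, Ideal.mem_span_singleton,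
    dvd_prime_pow Polynomial.prime_X] at h1
  obtain ⟨a, _, ha⟩ := h1
  refine ⟨a, (hasType_congr ((Submodule.quotEquivOfEq _ _ ?_) ≪≫ₗ
    Ideal.quotTorsionOfEquivSpanSingleton k[X] M x)).1 (hasType_cyc a)⟩
  rw [hg, Ideal.submodule_span_eq, Ideal.span_singleton_eq_span_singleton]
  exact ha.symm

/-- Write x = f·g with g a generator. Since x is not in TU, f is prime to T and so invertible modulo
T^a. -/
theorem span_eq_of_notMem {U : Submodule k[X] M} {a : ℕ} (hU : HasType k U (row a)) {x : M}
    (hx : x ∈ U) (hx' : x ∉ U.map (shiftMap k M 1)) : Submodule.span k[X] {x} = U := by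
  obtain ⟨e⟩ := hU
  obtain ⟨e'⟩ := hasType_cyc (k := k) a
  set E : U ≃ₗ[k[X]] Cyc k a := e ≪≫ₗ e'.symm
  set g : U := E.symm (Submodule.Quotient.mk 1) with hg
  have hgen : ∀ y : U, ∃ f : k[X], y = f • g := fun y => by
    obtain ⟨f, hf⟩ := Submodule.Quotient.mk_surjective _ (E y)
    refine ⟨f, E.injective ?_⟩
    rw [map_smul, hg, E.apply_symm_apply, ← hf, ← Submodule.Quotient.mk_smul, smul_eq_mul, mul_one]
  obtain ⟨f, hf⟩ := hgen ⟨x, hx⟩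
  have hXg : (Polynomial.X : k[X]) ^ a • g = 0 := by
    apply E.injective
    rw [map_smul, hg, E.apply_symm_apply, map_zero, ← Submodule.Quotient.mk_smul, Cyc.mk_eq_zero]
    simp
  have hco : IsCoprime f (Polynomial.X ^ a) := by
    refine IsCoprime.pow_right (((Polynomial.irreducible_X.coprime_iff_not_dvd).2 ?_).symm)
    rintro ⟨f', rfl⟩
    refine hx' ⟨(f' • g : U).1, (f' • g).2, ?_⟩
    rw [LinearMap.lsmul_apply, pow_one]
    have h := congrArg Subtype.val hf
    rw [mul_smul] at h
    exact h.symm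
  obtain ⟨u, v, huv⟩ := hco
  have hgx : g = u • (⟨x, hx⟩ : U) := by
    rw [hf, smul_smul]
    conv_lhs => rw [← one_smul k[X] g, ← huv, add_smul, mul_smul v, hXg, smul_zero, add_zero]
  apply le_antisymm
  · rwa [Submodule.span_singleton_le_iff_mem]
  · intro y hy
    obtain ⟨f', hf'⟩ := hgen ⟨y, hy⟩
    rw [Submodule.mem_span_singleton]
    refine ⟨f' * u, ?_⟩
    rw [mul_smul]
    have h := congrArg Subtype.val hf'
    rw [hgx] at h
    exact h.symm

variable [Finite k] [Finite M]

theorem row_fst (a : ℕ) : (row a).1 = a := rfl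

/-- The number of generators of a cyclic module of length `a` over a field with `n` elements. -/
def numGen (n a : ℕ) : ℤ := if a = 0 then 1 else (n : ℤ) ^ a - (n : ℤ) ^ (a - 1)

/-- For a > 0 the generators are the elements of U outside TU, which has dimension a - 1; the zero
module has the single generator 0. -/
theorem card_generators {U : Submodule k[X] M} {a : ℕ} (hU : HasType k U (row a)) :
    (Nat.card {x : M // Submodule.span k[X] {x} = U} : ℤ) = numGen (Nat.card k) a := by
  rw [numGen]
  split_ifs with ha
  · subst ha
    have hU0 : U = ⊥ := sz_eq_zero_iff.1 hU.sz_eq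
    subst hU0
    simp
  · set V := U.map (shiftMap k M 1) with hV
    have hVU : V ≤ U := by
      rintro _ ⟨y, hy, rfl⟩
      exact U.smul_mem _ hy
    have hszV : sz k V = a - 1 := by rw [hV, ← rk_submodule, hU.rk_eq, prk_row]
    have hszU : sz k U = a := hU.sz_eq
    have h1 : ∀ x : M, Submodule.span k[X] {x} = U ↔ x ∈ U ∧ ¬ x ∈ V := by
      intro x
      constructor
      · intro h
        refine ⟨h ▸ Submodule.mem_span_singleton_self x, fun hx => ?_⟩
        have hle : U ≤ V := by
          rw [← h]
          exact (Submodule.span_singleton_le_iff_mem _ _).2 hx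
        have := sz_mono (k := k) hle
        omega
      · rintro ⟨h, h'⟩
        exact span_eq_of_notMem hU h h'
    have h2 := natCard_subtype_split (fun x : M => x ∈ U) fun x => x ∈ V
    have h3 : Nat.card {x : M // x ∈ U ∧ x ∈ V} = Nat.card V :=
      Nat.card_congr (Equiv.subtypeEquivRight fun x => and_iff_right_of_imp fun h => hVU h)
    have h4 : Nat.card {x : M // x ∈ U} = Nat.card k ^ a := by
      rw [← hszU]; exact card_eq_pow_sz U
    rw [h3, card_eq_pow_sz (k := k) V, hszV, h4] at h2
    simp only [h1]
    have h5 := congrArg (Nat.cast (R := ℤ)) h2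
    push_cast at h5
    rw [h5]
    ring

open Classical in
theorem card_generators_eq_sum (hM : IsNilp k M) (U : Submodule k[X] M) :
    (Nat.card {x : M // Submodule.span k[X] {x} = U} : ℤ) =
      ∑ a ∈ Finset.range (sz k M + 1),
        if HasType k U (row a) then numGen (Nat.card k) a else 0 := by
  by_cases h : ∃ a, HasType k U (row a)
  · obtain ⟨a, ha⟩ := h
    rw [card_generators ha, Finset.sum_eq_single a, if_pos ha]
    · intro b _ hb
      rw [if_neg fun h => hb ?_]
      rw [← row_fst a, ← row_fst b, h.unique ha]
    · intro h
      refine absurd (Finset.mem_range.2 ?_) h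
      have := sz_add_sz_quotient (k := k) U
      rw [ha.sz_eq, row_fst] at this
      omega
  · rw [Finset.sum_eq_zero fun a _ => if_neg fun h' => h ⟨a, h'⟩]
    have : IsEmpty {x : M // Submodule.span k[X] {x} = U} := by
      refine ⟨fun x => h ?_⟩
      obtain ⟨a, ha⟩ := exists_hasType_span hM x.1
      rw [x.2] at ha
      exact ⟨a, ha⟩
    rw [Nat.card_of_isEmpty, Nat.cast_zero]

/-- The elements of M are sorted by the submodule they generate. -/
theorem sum_numGen_mul_card (hM : IsNilp k M) :
    ∑ a ∈ Finset.range (sz k M + 1), numGen (Nat.card k) a *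
      (Nat.card {U : Submodule k[X] M // HasType k U (row a)} : ℤ) = (Nat.card k : ℤ) ^ sz k M := by
  classical
  have := Fintype.ofFinite (Submodule k[X] M)
  have h1 : Nat.card M = ∑ U : Submodule k[X] M,
      Nat.card {x : M // Submodule.span k[X] {x} = U} := by
    rw [← Nat.card_sigma]
    exact Nat.card_congr (Equiv.sigmaFiberEquiv _).symm
  have h2 := congrArg (Nat.cast (R := ℤ)) h1
  rw [card_eq_pow_sz (k := k) M] at h2
  push_cast at h2
  rw [h2, Finset.sum_congr rfl fun U _ => card_generators_eq_sum hM U, Finset.sum_comm]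
  refine Finset.sum_congr rfl fun a _ => ?_
  rw [← Finset.sum_filter, Finset.sum_const, nsmul_eq_mul, mul_comm, Nat.card_eq_fintype_card,
    Fintype.card_subtype]

theorem card_hasType_eq_sum (hM : IsNilp k M) (m : Ptn) {n : ℕ} (hn : m.1 + n = sz k M) :
    Nat.card {U : Submodule k[X] M // HasType k U m} =
      ∑ y : n.Partition, hallCount k M ⟨n, y⟩ m := by
  classical
  have := Fintype.ofFinite {U : Submodule k[X] M // HasType k U m}
  have h := sum_sum_ite (fun U : Submodule k[X] M => HasType k U m)
    (fun (y : n.Partition) U => HasType k (M ⧸ U) ⟨n, y⟩) fun _ => 1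
  simp only [one_mul] at h
  refine Eq.trans ?_ h
  rw [Finset.sum_congr rfl fun U _ => ?_, Finset.sum_const, smul_eq_mul, mul_one, Finset.card_univ,
    Nat.card_eq_fintype_card]
  obtain ⟨l, hl⟩ := exists_hasType (hM.quotient U.1)
  have hsz := sz_add_sz_quotient (k := k) U.1
  rw [U.2.sz_eq, hl.sz_eq] at hsz
  obtain ⟨y, rfl⟩ := exists_partition_eq (show l.1 = n by omega)
  rw [Finset.sum_eq_single y, if_pos hl]
  · intro z _ hz
    rw [if_neg fun h => hz ?_]
    simpa using h.unique hl
  · simp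

theorem sum_hallNumber_row (x : Ptn) :
    ∑ a ∈ Finset.Icc 1 x.1, ((Nat.card k : ℤ) ^ a - (Nat.card k : ℤ) ^ (a - 1)) *
      ∑ y : (x.1 - a).Partition, (hallNumber k ⟨_, y⟩ (row a) x : ℤ) =
        (Nat.card k : ℤ) ^ x.1 - 1 := by
  have h := sum_numGen_mul_card (isNilp_nilp (k := k) x)
  have hs : sz k (Nilp k x) = x.1 := sz_nilp x
  simp only [hs] at h
  -- The split-off term a = 0 accounts for the zero element and becomes the -1 on the right.
  rw [Finset.range_eq_Ico, Finset.sum_eq_sum_Ico_succ_bot (Nat.succ_pos _)] at h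
  have h0 : Nat.card {U : Submodule k[X] (Nilp k x) // HasType k U (row 0)} = 1 := by
    have : ∀ U : Submodule k[X] (Nilp k x), HasType k U (row 0) ↔ U = ⊥ := by
      intro U
      constructor
      · exact fun h => sz_eq_zero_iff.1 h.sz_eq
      · rintro rfl
        rw [hasType_iff ((isNilp_nilp x).submodule _)]
        intro j
        rw [prk_row, rk_submodule, Submodule.map_bot, Nat.zero_sub, sz_eq_zero_iff]
    simp only [this]
    simp
  rw [h0, show numGen (Nat.card k) 0 = 1 from rfl] at h
  rw [← h]
  push_cast
  rw [add_sub_cancel_left]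
  refine Finset.sum_congr (by ext; simp) fun a ha => ?_
  obtain ⟨h1, h2⟩ := Finset.mem_Ico.1 ha
  rw [numGen, if_neg (by omega), card_hasType_eq_sum (isNilp_nilp x) (row a) (n := x.1 - a)
    (by rw [hs, row_fst]; omega), Nat.cast_sum]
  rfl

end

theorem sum_hallPolynomial_row (x : Ptn) :
    ∑ a ∈ Finset.Icc 1 x.1, ((Polynomial.X : ℤ[X]) ^ a - Polynomial.X ^ (a - 1)) *
      ∑ y : (x.1 - a).Partition, hallPolynomial ⟨_, y⟩ (row a) x = Polynomial.X ^ x.1 - 1 :=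
  eq_of_eval_card_eq fun k _ _ => by
    simp only [Polynomial.eval_finsetSum, Polynomial.eval_mul, Polynomial.eval_sub,
      Polynomial.eval_pow, Polynomial.eval_X, Polynomial.eval_one, eval_hallPolynomial]
    exact sum_hallNumber_row x

/-! ### Generating functions -/

section

variable {R : Type*} [CommRing R] [Algebra ℚ R]

open PowerSeries

/-- The equation F' = F·A determines the coefficients recursively from the constant term, as n + 1
can be cancelled over ℚ. It replaces exponentials and logarithms in what follows. -/
theorem eq_of_derivative_eq_mul {F G A : R⟦X⟧} (hF : d⁄dX R F = F * A) (hG : d⁄dX R G = G * A)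
    (h0 : coeff 0 F = coeff 0 G) : F = G := by
  have := IsAddTorsionFree.of_module_rat (M := R)
  ext n
  induction n using Nat.strong_induction_on with
  | _ n ih =>
  cases n with
  | zero => exact h0
  | succ n =>
    have h1 := congrArg (coeff n) hF
    have h2 := congrArg (coeff n) hG
    rw [coeff_derivative, coeff_mul] at h1 h2
    have h3 : coeff (n + 1) F * (n + 1 : R) = coeff (n + 1) G * (n + 1 : R) := by
      rw [h1, h2]
      refine Finset.sum_congr rfl fun p hp => ?_
      have := Finset.HasAntidiagonal.mem_antidiagonal.1 hp
      rw [ih p.1 (by omega)]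
    refine nsmul_right_injective (Nat.succ_ne_zero n) ?_
    simp only [nsmul_eq_mul]
    push_cast
    rw [mul_comm, h3, mul_comm]

theorem derivative_exp_subst {L : R⟦X⟧} (hL : constantCoeff L = 0) :
    d⁄dX R ((exp R).subst L) = (exp R).subst L * d⁄dX R L := by
  rw [derivative_subst (HasSubst.of_constantCoeff_zero' hL), derivative_exp]

theorem coeff_zero_exp_subst {L : R⟦X⟧} (hL : constantCoeff L = 0) :
    coeff 0 ((exp R).subst L : R⟦X⟧) = 1 := by
  have hs := HasSubst.of_constantCoeff_zero' hL
  have h1 : (exp R).subst L = (exp R - 1).subst L + (1 : R⟦X⟧) := by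
    have h2 : (1 : R⟦X⟧).subst L = (1 : R⟦X⟧) := by
      rw [← coe_substAlgHom hs, map_one]
    conv_lhs => rw [← sub_add_cancel (exp R) 1, subst_add hs, h2]
  have h3 : constantCoeff ((exp R - 1).subst L : R⟦X⟧) = 0 :=
    constantCoeff_subst_eq_zero hL _ (by simp)
  rw [h1, map_add, coeff_zero_eq_constantCoeff_apply, h3]
  simp

theorem coeff_derivative_mk (f : ℕ → R) (n : ℕ) :
    coeff n (d⁄dX R (PowerSeries.mk fun n => (1 / n : ℚ) • f n)) = f (n + 1) := by
  rw [coeff_derivative, coeff_mk]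
  rw [show ((n : R) + 1) = algebraMap ℚ R ((n : ℚ) + 1) by simp, mul_comm, ← Algebra.smul_def,
    smul_smul]
  push_cast
  rw [mul_one_div_cancel (by positivity), one_smul]

theorem derivative_mul_eq_mul {F G A B : R⟦X⟧} (hF : d⁄dX R F = F * A) (hG : d⁄dX R G = G * B) :
    d⁄dX R (F * G) = F * G * (A + B) := by
  rw [Derivation.leibniz, hF, hG, smul_eq_mul, smul_eq_mul]
  ring

theorem derivative_map {S : Type*} [CommRing S] (φ : R →+* S) (F : R⟦X⟧) :
    d⁄dX S (F.map φ) = (d⁄dX R F).map φ := by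
  ext n
  simp [coeff_derivative]

end

open PowerSeries

theorem p_zero : p 0 = 0 := by simp [p]

/-- The series `∑ p_{j + 1} T ^ j`. -/
def powerSumSeries : SymFun⟦X⟧ := PowerSeries.mk fun j => p (j + 1)

/-- The series `∑ (1 - t ^ (j + 1)) p_{j + 1} T ^ j`. -/
def twistedPowerSumSeries : SymT⟦X⟧ :=
  PowerSeries.mk fun j => (1 - (Polynomial.X : SymT) ^ (j + 1)) * Polynomial.C (p (j + 1))

theorem derivative_mk_h : d⁄dX SymFun (PowerSeries.mk h) = PowerSeries.mk h * powerSumSeries := by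
  have h1 : PowerSeries.mk h = (exp SymFun).subst logH := by
    ext n; rw [coeff_mk, h]
  have h0 : constantCoeff logH = 0 := by
    rw [← coeff_zero_eq_constantCoeff_apply, logH, coeff_mk, p_zero, smul_zero]
  rw [h1, derivative_exp_subst h0]
  congr 1
  ext1 n
  rw [powerSumSeries, coeff_mk, logH, coeff_derivative_mk]

theorem h_zero : h 0 = 1 := by
  rw [h, coeff_zero_exp_subst]
  rw [← coeff_zero_eq_constantCoeff_apply, logH, coeff_mk, p_zero, smul_zero]

theorem constantCoeff_logC : constantCoeff logC = 0 := by
  rw [← coeff_zero_eq_constantCoeff_apply, logC, coeff_mk, p_zero, map_zero, mul_zero, smul_zero]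

theorem derivative_mk_c :
    d⁄dX SymT (PowerSeries.mk c) = PowerSeries.mk c * twistedPowerSumSeries := by
  have h1 : PowerSeries.mk c = (exp SymT).subst logC := by
    ext1 n; rw [coeff_mk, c]
  have h2 : d⁄dX SymT logC = twistedPowerSumSeries := by
    ext1 n
    rw [twistedPowerSumSeries, coeff_mk]
    exact coeff_derivative_mk (fun n => (1 - (Polynomial.X : SymT) ^ n) * Polynomial.C (p n)) n
  rw [h1, derivative_exp_subst constantCoeff_logC, h2]

theorem c_zero : c 0 = 1 := by
  rw [c, coeff_zero_exp_subst constantCoeff_logC]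

/-- The identity `C(T) H(t T) = H(T)`. -/
theorem sum_c_mul_h (r : ℕ) :
    ∑ a ∈ Finset.HasAntidiagonal.antidiagonal r,
      c a.1 * ((Polynomial.X : SymT) ^ a.2 * Polynomial.C (h a.2)) = Polynomial.C (h r) := by
  set H : SymT⟦X⟧ := (PowerSeries.mk h).map Polynomial.C with hH
  set P : SymT⟦X⟧ := powerSumSeries.map Polynomial.C with hP
  set Ht : SymT⟦X⟧ := PowerSeries.mk fun n => (Polynomial.X : SymT) ^ n * Polynomial.C (h n)
    with hHt
  set Pt : SymT⟦X⟧ :=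
    PowerSeries.mk fun j => (Polynomial.X : SymT) ^ (j + 1) * Polynomial.C (p (j + 1)) with hPt
  have hdH : d⁄dX SymT H = H * P := by
    rw [hH, derivative_map, derivative_mk_h, map_mul]
  -- The chain rule for T ↦ tT, checked on coefficients.
  have hdHt : d⁄dX SymT Ht = Ht * Pt := by
    ext1 n
    have h1 := congrArg (coeff n) hdH
    rw [coeff_derivative, coeff_mul] at h1 ⊢
    simp only [hH, hP, hHt, hPt, powerSumSeries, coeff_mk, coeff_map] at h1 ⊢
    rw [mul_assoc, h1, Finset.mul_sum]
    refine Finset.sum_congr rfl fun a ha => ?_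
    rw [← Finset.HasAntidiagonal.mem_antidiagonal.1 ha]
    ring
  have hsum : twistedPowerSumSeries + Pt = P := by
    ext1 n
    simp only [hP, hPt, powerSumSeries, twistedPowerSumSeries, coeff_mk, coeff_map, map_add]
    ring
  have hprod : d⁄dX SymT (PowerSeries.mk c * Ht) = (PowerSeries.mk c * Ht) * P := by
    rw [← hsum]
    exact derivative_mul_eq_mul derivative_mk_c hdHt
  have heq := eq_of_derivative_eq_mul hprod hdH (by
    simp [hHt, hH, c_zero, h_zero, coeff_mk, coeff_map])
  have h2 := congrArg (coeff r) heq
  rw [coeff_mul] at h2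
  simpa only [hHt, hH, coeff_mk, coeff_map] using h2

section

variable {R : Type*} [CommRing R] [Algebra ℚ R] {t : R}

/-- The elements `c_r` may be sent anywhere. -/
theorem exists_ringHom (ht : ∀ r : ℕ, IsUnit (1 - t ^ (r + 1))) (C : ℕ → R) (hC : C 0 = 1) :
    ∃ Φ : SymT →+* R, Φ Polynomial.X = t ∧ ∀ r, Φ (c r) = C r := by
  set F : R⟦X⟧ := PowerSeries.mk C with hF
  set A : R⟦X⟧ := invOfUnit F 1 * d⁄dX R F with hA
  have hFA : d⁄dX R F = F * A := by
    rw [hA, ← mul_assoc, mul_invOfUnit F 1 (by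
      rw [← coeff_zero_eq_constantCoeff_apply, hF, coeff_mk, hC, Units.val_one]), one_mul]
  choose v hv using fun r => (ht r).exists_right_inv
  -- A is the logarithmic derivative of the prescribed series, and its coefficient of T^(n-1) must
  -- be the image of (1 - t^n) p_n.
  let π : ℕ+ → R := fun n => v (n.1 - 1) * coeff (n.1 - 1) A
  let Φ : SymT →+* R :=
    Polynomial.eval₂RingHom (MvPolynomial.eval₂Hom (algebraMap ℚ R) π) t
  have hX : Φ Polynomial.X = t := Polynomial.eval₂_X _ _
  have hp : ∀ j, Φ (Polynomial.C (p (j + 1))) = v j * coeff j A := by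
    intro j
    rw [p, dif_pos (Nat.succ_pos j)]
    exact (Polynomial.eval₂_C _ _).trans (MvPolynomial.eval₂_X _ _ _)
  refine ⟨Φ, hX, fun r => ?_⟩
  have h1 : d⁄dX R ((PowerSeries.mk c).map Φ) = (PowerSeries.mk c).map Φ * A := by
    rw [derivative_map, derivative_mk_c, map_mul]
    congr 1
    ext1 j
    rw [coeff_map, twistedPowerSumSeries, coeff_mk, map_mul, hp, map_sub, map_one, map_pow, hX,
      ← mul_assoc, hv, one_mul]
  have h2 := eq_of_derivative_eq_mul h1 hFA (by
    rw [coeff_map, coeff_mk, c_zero, map_one, hF, coeff_mk, hC])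
  have h3 := congrArg (coeff r) h2
  rwa [coeff_map, coeff_mk, hF, coeff_mk] at h3

/-- The logarithmic derivative of C(T) recovers the images of (1 - t^n) p_n, and 1 - t^n maps to a
unit, so the images of all p_n agree. -/
theorem ringHom_eq_of_map_c_eq (ht : ∀ r : ℕ, IsUnit (1 - t ^ (r + 1))) {Φ Ψ : SymT →+* R}
    (hΦ : Φ Polynomial.X = t) (hΨ : Ψ Polynomial.X = t) (hc : ∀ r, Φ (c r) = Ψ (c r)) :
    Φ = Ψ := by
  have h1 : (PowerSeries.mk c).map Φ = (PowerSeries.mk c).map Ψ := by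
    ext1 r
    rw [coeff_map, coeff_map, coeff_mk, hc]
  have h2 : twistedPowerSumSeries.map Φ = twistedPowerSumSeries.map Ψ := by
    have h3 := congrArg (d⁄dX R) h1
    rw [derivative_map, derivative_map, derivative_mk_c, map_mul, map_mul, ← h1] at h3
    have h4 := congrArg (invOfUnit ((PowerSeries.mk c).map Φ) 1 * ·) h3
    simp only [← mul_assoc] at h4
    rwa [invOfUnit_mul _ 1 (by
      rw [← coeff_zero_eq_constantCoeff_apply, coeff_map, coeff_mk, c_zero, map_one,
        Units.val_one]), one_mul, one_mul] at h4
  have hp : ∀ j, Φ (Polynomial.C (p (j + 1))) = Ψ (Polynomial.C (p (j + 1))) := by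
    intro j
    have h3 := congrArg (coeff j) h2
    rw [coeff_map, coeff_map, twistedPowerSumSeries, coeff_mk, map_mul, map_mul, map_sub,
      map_sub, map_one, map_one, map_pow, map_pow, hΦ, hΨ] at h3
    exact (ht j).mul_left_cancel h3
  refine Polynomial.ringHom_ext' (MvPolynomial.ringHom_ext (fun a => ?_) fun n => ?_)
    (hΦ.trans hΨ.symm)
  · exact RingHom.congr_fun (RingHom.ext_rat
      ((Φ.comp Polynomial.C).comp MvPolynomial.C) ((Ψ.comp Polynomial.C).comp MvPolynomial.C)) a
  · have h3 := hp (n.1 - 1)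
    have h4 : n.1 - 1 + 1 = n.1 := Nat.sub_add_cancel n.2
    rw [h4, p, dif_pos n.2] at h3
    exact h3

end

/-! ### The ring structure of `H_1` -/

theorem repr_u (l x : Ptn) [Decidable (l = x)] : basis.repr (u l) x = if l = x then 1 else 0 := by
  classical
  rw [u, Module.Basis.repr_self, Finsupp.single_apply]

theorem ext_repr {f g : H1} (h : ∀ x, basis.repr f x = basis.repr g x) : f = g :=
  basis.repr.injective (Finsupp.ext h)

theorem repr_sum_smul_u {n : ℕ} (a : n.Partition → Qv) (x : n.Partition) :
    basis.repr (∑ y, a y • u ⟨n, y⟩) ⟨n, x⟩ = a x := by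
  classical
  rw [map_sum, Finsupp.finsetSum_apply, Finset.sum_eq_single x]
  · rw [map_smul, Finsupp.smul_apply, repr_u, if_pos rfl, smul_eq_mul, mul_one]
  · intro y _ hy
    rw [map_smul, Finsupp.smul_apply, repr_u, if_neg fun h => hy (by simpa using h), smul_zero]
  · simp

theorem repr_sum_smul_u_of_ne {n : ℕ} (a : n.Partition → Qv) {x : Ptn} (hx : x.1 ≠ n) :
    basis.repr (∑ y, a y • u ⟨n, y⟩) x = 0 := by
  classical
  rw [map_sum, Finsupp.finsetSum_apply, Finset.sum_eq_zero]
  intro y _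
  rw [map_smul, Finsupp.smul_apply, repr_u, if_neg, smul_zero]
  rintro rfl
  exact hx rfl

theorem repr_sum_u (n : ℕ) (x : Ptn) :
    basis.repr (∑ y : n.Partition, u ⟨n, y⟩) x = if x.1 = n then 1 else 0 := by
  have h : ∑ y : n.Partition, u ⟨n, y⟩ = ∑ y : n.Partition, (1 : Qv) • u ⟨n, y⟩ := by
    simp only [one_smul]
  rw [h]
  split_ifs with hx
  · subst hx
    exact repr_sum_smul_u _ x.2
  · exact repr_sum_smul_u_of_ne _ hx

/-- The structure constants of `H_1`. -/
theorem repr_u_mul_u (l m x : Ptn) :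
    basis.repr (u l * u m) x = Polynomial.aeval q (hallPolynomial l m x) := by
  rw [u_mul_u, basisMul]
  by_cases hx : x.1 = l.1 + m.1
  · obtain ⟨y, rfl⟩ := exists_partition_eq hx
    exact repr_sum_smul_u (fun y => Polynomial.aeval q (hallPolynomial l m ⟨_, y⟩)) y
  · rw [hallPolynomial_eq_zero hx, map_zero]
    exact repr_sum_smul_u_of_ne (fun y => Polynomial.aeval q (hallPolynomial l m ⟨_, y⟩)) hx

theorem H1_smul_mul (a : Qv) (f g : H1) : a • f * g = a • (f * g) := by
  rw [mul_def, map_smul, LinearMap.smul_apply, mul_def]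

theorem H1_mul_smul (a : Qv) (f g : H1) : f * a • g = a • (f * g) := by
  rw [mul_def, map_smul, mul_def]

theorem H1_induction {P : H1 → Prop} (hu : ∀ l, P (u l)) (hadd : ∀ f g, P f → P g → P (f + g))
    (hsmul : ∀ (a : Qv) f, P f → P (a • f)) (f : H1) : P f := by
  have hf : f ∈ Submodule.span Qv (Set.range basis) := by
    rw [basis.span_eq]; trivial
  induction hf using Submodule.span_induction with
  | mem x hx =>
    obtain ⟨l, rfl⟩ := hx
    exact hu l
  | zero => simpa using hsmul 0 _ (hu (row 0))
  | add f g _ _ hf hg => exact hadd f g hf hg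
  | smul a f _ hf => exact hsmul a f hf

theorem u_mul_u_mul_u (l m n : Ptn) : u l * u m * u n = u l * (u m * u n) := by
  refine ext_repr fun x => ?_
  rw [u_mul_u l m, u_mul_u m n, basisMul, basisMul, Finset.sum_mul, Finset.mul_sum]
  simp only [H1_smul_mul, H1_mul_smul, map_sum, map_smul, Finsupp.finsetSum_apply,
    Finsupp.smul_apply, repr_u_mul_u, smul_eq_mul, ← map_mul]
  rw [← map_sum, ← map_sum, hallPolynomial_assoc]

theorem H1_mul_assoc (f g h : H1) : f * g * h = f * (g * h) := by
  induction f using H1_induction with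
  | hadd f f' hf hf' => rw [add_mul, add_mul, add_mul, hf, hf']
  | hsmul a f hf => rw [H1_smul_mul, H1_smul_mul, H1_smul_mul, hf]
  | hu l =>
  induction g using H1_induction with
  | hadd g g' hg hg' => rw [mul_add, add_mul, add_mul, mul_add, hg, hg']
  | hsmul a g hg => rw [H1_mul_smul, H1_smul_mul, H1_smul_mul, H1_mul_smul, hg]
  | hu m =>
  induction h using H1_induction with
  | hadd h h' hh hh' => rw [mul_add, mul_add, mul_add, hh, hh']
  | hsmul a h hh => rw [H1_mul_smul, H1_mul_smul, H1_mul_smul, hh]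
  | hu n => exact u_mul_u_mul_u l m n

theorem H1_mul_comm (f g : H1) : f * g = g * f := by
  induction f using H1_induction with
  | hadd f f' hf hf' => rw [add_mul, mul_add, hf, hf']
  | hsmul a f hf => rw [H1_smul_mul, H1_mul_smul, hf]
  | hu l =>
  induction g using H1_induction with
  | hadd g g' hg hg' => rw [mul_add, add_mul, hg, hg']
  | hsmul a g hg => rw [H1_mul_smul, H1_smul_mul, hg]
  | hu m =>
  refine ext_repr fun x => ?_
  rw [repr_u_mul_u, repr_u_mul_u, hallPolynomial_comm]

theorem H1_mul_one (f : H1) : f * 1 = f := by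
  classical
  induction f using H1_induction with
  | hadd f f' hf hf' => rw [add_mul, hf, hf']
  | hsmul a f hf => rw [H1_smul_mul, hf]
  | hu l =>
  refine ext_repr fun x => ?_
  have h : hallPolynomial l (row 0) x = if l = x then 1 else 0 :=
    eq_of_eval_card_eq fun k _ _ => by
      rw [eval_hallPolynomial, hallNumber_of_fst_eq_zero rfl]
      split_ifs <;> simp
  rw [show (1 : H1) = u (row 0) from rfl, repr_u_mul_u, repr_u, h]
  split_ifs <;> simp

/-- The commutative ring structure of `H_1`. -/
abbrev H1.commRing : CommRing H1 :=
  { (inferInstance : NonUnitalNonAssocRing H1), (inferInstance : One H1) with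
    mul_assoc := H1_mul_assoc
    mul_comm := H1_mul_comm
    mul_one := H1_mul_one
    one_mul := fun f => (H1_mul_comm 1 f).trans (H1_mul_one f) }

/-! ### The element `∑ u_x` -/

theorem q_ne_zero : q ≠ 0 := pow_ne_zero _ RatFunc.X_ne_zero

theorem q_pow_ne_one (n : ℕ) : q ^ (n + 1) ≠ 1 := by
  intro h
  have h1 : algebraMap ℚ[X] Qv (Polynomial.X ^ (2 * (n + 1))) = algebraMap ℚ[X] Qv 1 := by
    rw [map_pow, RatFunc.algebraMap_X, map_one, ← h, q, pow_mul]
  have h2 := congrArg Polynomial.natDegree (RatFunc.algebraMap_injective ℚ h1)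
  simp at h2

/-- At u_x with |x| = r this is `sum_hallPolynomial_row`, evaluated at q and divided by q^r; all
other coefficients vanish on both sides. -/
theorem sum_smul_sum_mul_row (r : ℕ) :
    ∑ a ∈ Finset.Icc 1 r, (q ^ ((a : ℤ) - (r : ℤ)) * (1 - q⁻¹)) •
      ∑ l : (r - a).Partition, u ⟨r - a, l⟩ * u (row a) =
        (1 - q ^ (-(r : ℤ))) • ∑ x : r.Partition, u ⟨r, x⟩ := by
  have hq := q_ne_zero
  refine ext_repr fun x => ?_
  rw [map_smul, Finsupp.smul_apply, repr_sum_u]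
  simp only [map_sum, map_smul, Finsupp.finsetSum_apply, Finsupp.smul_apply, repr_u_mul_u,
    smul_eq_mul]
  by_cases hx : x.1 = r
  · subst hx
    have h := congrArg (Polynomial.aeval q) (sum_hallPolynomial_row x)
    simp only [map_sum, map_mul, map_sub, map_pow, Polynomial.aeval_X, map_one] at h
    rw [if_pos rfl, mul_one]
    have h1 : (1 : Qv) - q ^ (-(x.1 : ℤ)) = q ^ (-(x.1 : ℤ)) * (q ^ x.1 - 1) := by
      rw [mul_sub, zpow_neg, zpow_natCast, inv_mul_cancel₀ (pow_ne_zero _ hq), mul_one]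
    rw [h1, ← h, Finset.mul_sum]
    refine Finset.sum_congr rfl fun a ha => ?_
    rw [← mul_assoc]
    congr 1
    obtain ⟨b, rfl⟩ := Nat.exists_eq_add_of_le' (Finset.mem_Icc.1 ha).1
    rw [sub_eq_add_neg (((b + 1 : ℕ) : ℤ)), zpow_add₀ hq, zpow_natCast, Nat.add_sub_cancel, pow_succ]
    field_simp
  · rw [if_neg hx, mul_zero]
    refine Finset.sum_eq_zero fun a ha => ?_
    rw [Finset.sum_eq_zero, mul_zero]
    intro y _
    rw [hallPolynomial_eq_zero, map_zero]
    rw [row_fst]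
    have := (Finset.mem_Icc.1 ha).2
    dsimp only
    omega

/-! ### Existence, uniqueness and values of Φ_1. -/

section

attribute [local instance] H1.commRing

local instance : Algebra Qv H1 := Algebra.ofModule H1_smul_mul H1_mul_smul

local instance : Algebra ℚ H1 :=
  ((algebraMap Qv H1).comp (algebraMap ℚ Qv)).toAlgebra

theorem isUnit_one_sub_pow (r : ℕ) : IsUnit (1 - (q⁻¹ • (1 : H1)) ^ (r + 1)) := by
  have h1 : (1 : H1) - (q⁻¹ • (1 : H1)) ^ (r + 1) = algebraMap Qv H1 (1 - q⁻¹ ^ (r + 1)) := by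
    rw [map_sub, map_one, map_pow, Algebra.algebraMap_eq_smul_one]
  rw [h1]
  refine IsUnit.map _ (isUnit_iff_ne_zero.2 (sub_ne_zero.2 fun h => q_pow_ne_one r ?_))
  rw [inv_pow] at h
  exact (inv_eq_one.1 h.symm)

/-- The images of the `c_r`. -/
def cImage (r : ℕ) : H1 := if r = 0 then 1 else (1 - q⁻¹) • u (row r)

theorem exists_phi : ∃ Φ : SymT →+* H1,
    Φ Polynomial.X = q⁻¹ • (1 : H1) ∧ ∀ r, Φ (c r) = cImage r :=
  exists_ringHom isUnit_one_sub_pow cImage rfl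

theorem map_h_eq {Φ : SymT →+* H1} (hX : Φ Polynomial.X = q⁻¹ • (1 : H1))
    (hc : ∀ r, Φ (c r) = cImage r) (r : ℕ) :
    Φ (Polynomial.C (h r)) = ∑ x : r.Partition, u ⟨r, x⟩ := by
  induction r using Nat.strong_induction_on with
  | _ r ih =>
  rcases Nat.eq_zero_or_pos r with rfl | hr
  · rw [h_zero, map_one, map_one, Fintype.sum_unique]
    rfl
  · have h1 := congrArg Φ (sum_c_mul_h r)
    rw [map_sum, Finset.Nat.sum_antidiagonal_eq_sum_range_succ_mk, Finset.range_eq_Ico,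
      Finset.sum_eq_sum_Ico_succ_bot (Nat.succ_pos r)] at h1
    simp only [map_mul, map_pow, hX, hc, Nat.sub_zero, smul_pow, one_pow] at h1
    have h2 := sum_smul_sum_mul_row r
    set S := ∑ x : r.Partition, u ⟨r, x⟩ with hS
    set Y := Φ (Polynomial.C (h r)) with hY
    -- By induction the terms with a ≥ 1 of the image of C(T) H(tT) = H(T) form the left side of
    -- (1). The term a = 0 is q^(-r) Φ(h_r), so (1 - q^(-r)) can be cancelled at the end.
    have h3 : ∑ a ∈ Finset.Ico (0 + 1) r.succ,
        cImage a * ((q⁻¹ ^ (r - a) • (1 : H1)) * Φ (Polynomial.C (h (r - a)))) =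
          (1 - q ^ (-(r : ℤ))) • S := by
      rw [← h2]
      refine Finset.sum_congr (by ext; simp) fun a ha => ?_
      obtain ⟨ha1, ha2⟩ := Finset.mem_Ico.1 ha
      rw [ih _ (by omega), cImage, if_neg (by omega), ← Finset.sum_mul, H1_smul_mul, H1_smul_mul,
        one_mul, H1_mul_smul, smul_smul, H1_mul_comm]
      congr 1
      rw [mul_comm, inv_pow, ← zpow_natCast, ← zpow_neg]
      congr 2
      push_cast [Nat.le_of_lt_succ ha2]
      ring
    rw [h3, show cImage 0 = 1 from rfl, one_mul, H1_smul_mul, one_mul] at h1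
    have h4 : (1 - q ^ (-(r : ℤ))) • S = (1 - q ^ (-(r : ℤ))) • Y := by
      rw [sub_smul (1 : Qv) _ Y, one_smul, zpow_neg, zpow_natCast, ← inv_pow]
      rw [zpow_neg, zpow_natCast, ← inv_pow] at h1
      exact eq_sub_of_add_eq' h1
    have h5 : (1 : Qv) - q ^ (-(r : ℤ)) ≠ 0 := by
      obtain ⟨n, rfl⟩ := Nat.exists_eq_succ_of_ne_zero hr.ne'
      rw [zpow_neg, zpow_natCast, sub_ne_zero, ne_eq, eq_comm, inv_eq_one]
      exact q_pow_ne_one n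
    exact (smul_right_injective H1 h5 h4).symm

theorem phi_unique {Φ Ψ : SymT →+* H1} (hX : Φ Polynomial.X = q⁻¹ • (1 : H1))
    (hc : ∀ r, Φ (c r) = cImage r) (hX' : Ψ Polynomial.X = q⁻¹ • (1 : H1))
    (hc' : ∀ r, Ψ (c r) = cImage r) : Ψ = Φ :=
  ringHom_eq_of_map_c_eq isUnit_one_sub_pow hX' hX fun r => (hc' r).trans (hc r).symm

/-- A map as in `IsPhi1` as a homomorphism of commutative rings. -/
def toRingHom (Ψ : SymT →ₙ+* H1) (h1 : Ψ 1 = 1) : SymT →+* H1 where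
  toFun := Ψ
  map_one' := h1
  map_mul' := map_mul Ψ
  map_zero' := map_zero Ψ
  map_add' := map_add Ψ

/-- A homomorphism of commutative rings as a homomorphism of non-unital rings. -/
def ofRingHom (Φ : SymT →+* H1) : SymT →ₙ+* H1 where
  toFun := Φ
  map_mul' := map_mul Φ
  map_zero' := map_zero Φ
  map_add' := map_add Φ

theorem exists_unique_phi : ∃ Φ : SymT →ₙ+* H1, IsPhi1 Φ ∧
    (∀ Ψ : SymT →ₙ+* H1, IsPhi1 Ψ → Ψ = Φ) ∧
      ∀ r : ℕ, Φ (Polynomial.C (h r)) = ∑ x : r.Partition, u ⟨r, x⟩ := by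
  obtain ⟨Φ, hX, hc⟩ := exists_phi
  refine ⟨ofRingHom Φ, ⟨map_one Φ, hX, fun r hr => ?_⟩, fun Ψ hΨ => ?_, map_h_eq hX hc⟩
  · refine (hc r).trans ?_
    rw [cImage, if_neg (by omega)]
  · have hcΨ : ∀ r, toRingHom Ψ hΨ.map_one (c r) = cImage r := by
      intro r
      rw [cImage]
      -- `IsPhi1` prescribes nothing at r = 0, where c_0 = 1 forces the value.
      split_ifs with hr
      · subst hr
        rw [c_zero, map_one]
      · exact hΨ.map_c r (by omega)
    have h := phi_unique hX hc hΨ.map_t hcΨ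
    ext x
    exact RingHom.congr_fun h x

end

end RingelHall

end

theorem mainTheorem7 :
    (∀ r : ℕ,
      ∑ a ∈ Finset.Icc 1 r,
          (RingelHall.q ^ ((a : ℤ) - (r : ℤ)) * (1 - RingelHall.q⁻¹)) •
            ∑ l : (r - a).Partition,
              RingelHall.u ⟨r - a, l⟩ * RingelHall.u (RingelHall.row a) =
        (1 - RingelHall.q ^ (-(r : ℤ))) • ∑ x : r.Partition, RingelHall.u ⟨r, x⟩) ∧
    ∃ Φ : RingelHall.SymT →ₙ+* RingelHall.H1,
      RingelHall.IsPhi1 Φ ∧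
      (∀ Ψ : RingelHall.SymT →ₙ+* RingelHall.H1, RingelHall.IsPhi1 Ψ → Ψ = Φ) ∧
      ∀ r : ℕ, Φ (Polynomial.C (RingelHall.h r)) =
        ∑ x : r.Partition, RingelHall.u ⟨r, x⟩ :=
  ⟨RingelHall.sum_smul_sum_mul_row, RingelHall.exists_unique_phi⟩
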